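/- Let $\mathbb{S}$ and $\mathbb{X}$ be finite sets. A unifilar source is given by probabilities $\pi(x,s'\mid s)$ ($s,s'\in\mathbb{S}$, $x\in\mathbb{X}$), with $\pi(\cdot,\cdot\mid s)$ a pmf on $\mathbb{X}\times\mathbb{S}$ for each $s$, and a function $\phi:\mathbb{S}\times\mathbb{X}\to\mathbb{S}$ with $\phi(s,\cdot)$ one-to-one for each $s$, such that $\pi(x,s'\mid s)\neq 0$ implies $s'=\phi(s,x)$. Put $\pi(x\mid s)=\sum_{s'}\pi(x,s'\mid s)$. Assume that the Markov chain of states, with transition probabilities $\sum_x\pi(x,s'\mid s)$, is irreducible. Fix an initial state $s_0\in\mathbb{S}$ and let $$P_n(x^n)=\sum_{s^n\in\mathbb{S}^n}\prod_{i=1}^n\pi(x_i,s_i\mid s_{i-1}),\qquad x^n\in\mathbb{X}^n .$$ Let $\mathcal{M}_s$ be the set of pmfs $Q$ on $\mathbb{S}\times\mathbb{X}$ that are stationary, i.e. $\sum_{(s,x):\phi(s,x)=s'}Q(s,x)=q(s')$ for all $s'$, where $q(s)=\sum_xQ(s,x)$. Write $Q=q\times\eta$, where $\eta(x\mid s)=Q(s,x)/q(s)$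 if $q(s)\ne0$ and $\eta(x\mid s)=1/|\mathbb{X}|$ otherwise. Let $H(\eta\mid q)=\sum_sq(s)H(\eta(\cdot\mid s))$ and $D(\eta\|\pi\mid q)=\sum_sq(s)D(\eta(\cdot\mid s)\|\pi(\cdot\mid s))\in[0,\infty]$, where $H$ is Shannon entropy and $D$ is relative entropy, with natural logarithms and $0\cdot\infty=0$. For $t\in\mathbb{R}$ put $$I(t)=\inf\Big\{D(\eta\|\pi\mid q): Q=q\times\eta\in\mathcal{M}_s,\ \sum_{s,x}Q(s,x)\ln\frac1{\pi(x\mid s)}=t\Big\},$$ where $0\ln\frac10=0$, a sum with a term $Q(s,x)>0=\pi(x\mid s)$ is $+\infty$, and $\inf\emptyset=\infty$. Then the following hold. 1. If $\nu_n$ is the distribution of $-n^{-1}\ln P_n(X^n)$ when $X^n$ has pmf $P_n$, then the sequence $(\nu_n)$ of probability measures on $\mathbb{R}$ satisfies the large deviation property with rate function $I$. That is, $I:\mathbb{R}\to[0,\infty]$ is lower semicontinuous and has compact level sets, $\limsup_n n^{-1}\ln\nu_n(K)\le-\inf_{K}I$ for every closed $K\subseteq\mathbb{R}$, and $\liminf_n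 n^{-1}\ln\nu_n(G)\ge-\inf_{G}I$ for every open $G\subseteq\mathbb{R}$. 2. For every $\rho>0$, let $G_n^*:\mathbb{X}^n\to\{1,\dots,|\mathbb{X}|^n\}$ be any bijections that order $\mathbb{X}^n$ by decreasing $P_n$-probability (ties broken arbitrarily). Then the limit $$E(\rho)=\lim_{n\to\infty}\frac1n\ln\mathbb{E}\big[G_n^*(X^n)^\rho\big]$$ exists, is finite, does not depend on the choice of the $G_n^*$, and $$E(\rho)=\sup_{Q=q\times\eta\in\mathcal{M}_s}\big\{\rho H(\eta\mid q)-D(\eta\|\pi\mid q)\big\}.$$ The supremum is the same when it is taken only over those $Q\in\mathcal{M}_s$ for which the Markov chain of states with transition probabilities $\sum_{x:\phi(s,x)=s'}\eta(x\mid s)$ is irreducible on $\mathbb{S}$. -/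

import Mathlib

open Filter Topology MeasureTheory

noncomputable section

namespace GuessingLDP

/-! ### Entropy and relative entropy of pmfs on a finite set -/

/-- Shannon entropy (natural logarithm) of a pmf on a finite set. -/
def entropy {α : Type*} [Fintype α] (p : α → ℝ) : ℝ := ∑ a, Real.negMulLog (p a)

open Classical in
/-- Relative entropy `D(p ‖ r)`, equal to `+∞` unless `p ≪ r`. -/
def relEntropy {α : Type*} [Fintype α] (p r : α → ℝ) : EReal :=
  if ∀ a, r a = 0 → p a = 0 then ((∑ a, p a * Real.log (p a / r a) : ℝ) : EReal) else ⊤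

/-! ### Guessing -/

/-- `G` is a guessing function on the finite set `α` (a bijection onto `{1, …, |α|}`) that proceeds
in decreasing order of the probabilities `P`; ties are broken arbitrarily. -/
def IsOptimalGuessing {α : Type*} [Fintype α] (P : α → ℝ) (G : α → ℕ) : Prop :=
  Set.BijOn G Set.univ (Set.Icc 1 (Fintype.card α)) ∧ ∀ a b, P b < P a → G a < G b

/-- The moment `𝔼[G(X)^ρ]`, where `X` has pmf `P`. -/
def guessingMoment {α : Type*} [Fintype α] (P : α → ℝ) (G : α → ℕ) (ρ : ℝ) : ℝ :=
  ∑ a, P a * (G a : ℝ) ^ ρ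

/-! ### Large deviation property -/

/-- The sequence `ν` of probability measures on `ℝ` satisfies the large deviation property with
rate function `I : ℝ → [0, ∞]`.  Here `ENNReal.log 0 = -∞`. -/
structure LargeDeviationProperty (ν : ℕ → Measure ℝ) (I : ℝ → EReal) : Prop where
  isProbabilityMeasure : ∀ n, IsProbabilityMeasure (ν n)
  nonneg : ∀ t, 0 ≤ I t
  lowerSemicontinuous : LowerSemicontinuous I
  isCompact_level : ∀ a : ℝ, IsCompact {t | I t ≤ (a : EReal)}
  limsup_le : ∀ K : Set ℝ, IsClosed K →
    limsup (fun n : ℕ => ENNReal.log (ν n K) / (n : EReal)) atTop ≤ - ⨅ t ∈ K, I t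
  le_liminf : ∀ G : Set ℝ, IsOpen G →
    - ⨅ t ∈ G, I t ≤ liminf (fun n : ℕ => ENNReal.log (ν n G) / (n : EReal)) atTop

/-- The distribution of the information spectrum `-n⁻¹ ln P(Xⁿ)`, where `Xⁿ` has pmf `P`. -/
def infoSpectrum {X : Type*} [Fintype X] (n : ℕ) (P : (Fin n → X) → ℝ) : Measure ℝ :=
  ∑ x, ENNReal.ofReal (P x) • Measure.dirac (-(n : ℝ)⁻¹ * Real.log (P x))

/-! ### Unifilar sources -/

/-- A unifilar source with finite state set `S` and finite alphabet `X`: `π s (x, s')` is the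
probability of letter `x` and next state `s'` given the current state `s`, and the next state is
the function `φ s x` of the current state and letter, one-to-one in the letter. -/
structure UnifilarSource (S X : Type*) [Fintype S] [Fintype X] where
  π : S → X × S → ℝ
  π_mem : ∀ s, π s ∈ stdSimplex ℝ (X × S)
  φ : S → X → S
  φ_injective : ∀ s, Function.Injective (φ s)
  eq_φ : ∀ s x s', π s (x, s') ≠ 0 → s' = φ s x

variable {S X : Type*} [Fintype S] [Fintype X]

namespace UnifilarSource

/-- `P_n(xⁿ, sⁿ) = ∏ᵢ π(xᵢ, sᵢ ∣ sᵢ₋₁)`, with initial state `s₀`. -/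
def jointProb (U : UnifilarSource S X) (s₀ : S) (n : ℕ) (x : Fin n → X) (s : Fin n → S) : ℝ :=
  ∏ i : Fin n, U.π ((Fin.cons s₀ s : Fin (n + 1) → S) i.castSucc) (x i, s i)

/-- `P_n(xⁿ)`, the pmf of the first `n` letters, with initial state `s₀`. -/
def prob (U : UnifilarSource S X) (s₀ : S) (n : ℕ) (x : Fin n → X) : ℝ :=
  ∑ s : Fin n → S, U.jointProb s₀ n x s

/-- `π(x ∣ s)`, the probability of letter `x` given the current state `s`. -/
def letterProb (U : UnifilarSource S X) (s : S) (x : X) : ℝ := ∑ s', U.π s (x, s')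

/-- The transition matrix of the Markov chain of states. -/
def stateMatrix (U : UnifilarSource S X) : Matrix S S ℝ :=
  Matrix.of fun s s' => ∑ x, U.π s (x, s')

/-- The source is irreducible if its Markov chain of states is. -/
def Irreducible (U : UnifilarSource S X) : Prop := U.stateMatrix.IsIrreducible

end UnifilarSource

/-! ### Stationary measures on `S × X` -/

/-- The marginal `q` of `Q` on `S`. -/
def stateMarginal (Q : S × X → ℝ) (s : S) : ℝ := ∑ x, Q (s, x)

open Classical in
/-- The conditional pmf `η(· ∣ s)` of the letter, so that `Q = q × η`. -/
def condLetter (Q : S × X → ℝ) (s : S) (x : X) : ℝ :=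
  if stateMarginal Q s ≠ 0 then Q (s, x) / stateMarginal Q s else 1 / (Fintype.card X : ℝ)

open Classical in
/-- Pmfs `Q` on `S × X` for which the process of states that starts with the marginal `q`, draws
letters by `η` and moves by `φ` is stationary. -/
def stationaryPmfs (φ : S → X → S) : Set (S × X → ℝ) :=
  {Q | Q ∈ stdSimplex ℝ (S × X) ∧
    ∀ s', (∑ s, ∑ x, if φ s x = s' then Q (s, x) else 0) = stateMarginal Q s'}

open Classical in
/-- The stationary pmfs for which, moreover, the Markov chain of states is irreducible on `S`. -/
def irreducibleStationaryPmfs (φ : S → X → S) : Set (S × X → ℝ) :=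
  {Q | Q ∈ stationaryPmfs φ ∧
    (Matrix.of fun s s' => ∑ x, if φ s x = s' then condLetter Q s x else 0 :
      Matrix S S ℝ).IsIrreducible}

/-- `H(η ∣ q) = ∑ₛ q(s) H(η(· ∣ s))`. -/
def condEntropy (Q : S × X → ℝ) : ℝ := ∑ s, stateMarginal Q s * entropy (condLetter Q s)

namespace UnifilarSource

/-- `D(η ‖ π ∣ q) = ∑ₛ q(s) D(η(· ∣ s) ‖ π(· ∣ s))`, with `0 · ∞ = 0`. -/
def condRelEntropy (U : UnifilarSource S X) (Q : S × X → ℝ) : EReal :=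
  ∑ s, (stateMarginal Q s : EReal) * relEntropy (condLetter Q s) (U.letterProb s)

/-- The set `θ(t)` of stationary `Q` with `∑ Q(s, x) ln (1 / π(x ∣ s)) = t`.  The sum is `+∞`, hence
not `t`, when `Q` charges a pair with `π(x ∣ s) = 0`. -/
def theta (U : UnifilarSource S X) (t : ℝ) : Set (S × X → ℝ) :=
  {Q | Q ∈ stationaryPmfs U.φ ∧ (∀ s x, U.letterProb s x = 0 → Q (s, x) = 0) ∧
    ∑ s, ∑ x, Q (s, x) * Real.log (1 / U.letterProb s x) = t}

/-- `I(t) = inf {D(η ‖ π ∣ q) : q × η ∈ θ(t)}`. -/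
def rate (U : UnifilarSource S X) (t : ℝ) : EReal := ⨅ Q ∈ U.theta t, U.condRelEntropy Q

end UnifilarSource

end GuessingLDP

end

/-!
The proof is the method of types. Since the next state is a function of the current state and the
letter, the probability of a word `x` is the product of the letter probabilities along the path of
states that `x` drives (`prob_eq_pathProd`), hence a function of the empirical distribution `T` of
the pairs (state, letter) along this path: `P_n(x) = exp (-n L(T))`, where
`L(Q) = ∑ Q(s, x) ln (1 / π(x ∣ s))` is linear (`prob_eq_exp`). On the pmfs `Q` that charge only
pairs of positive probability, `D(η ‖ π ∣ q) = L(Q) - H(η ∣ q)` (`condRelEntropy_eq`), and elsewhere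
it is `+∞`.

Upper bounds. There are polynomially many empirical distributions, each of them is shared by at most
`exp (n H(η ∣ q))` words (`card_pathCount_eq_le`), and by compactness those of long words may be
treated as stationary (`eventually_empirical_lt`), since along a path the visits to a state and the
departures from it differ by at most one. This bounds the probability of a closed set of information
rates, and also `∑ P_n(x) ^ (1 / (1 + ρ))`, whose power `1 + ρ` dominates the guessing moment
(`guessingMoment_le`).

Lower bounds. For an irreducible stationary `Q = q × η`, the law of large numbers for words whose
letters are drawn by `η` holds in mean square from any initial state: the solution of the Poisson
equation (`exists_poisson`) turns path sums into sums of increments with mean zero, up to bounded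
terms (`sum_pathProd_mul_sq_sub_le`). It provides about `exp (n H(η ∣ q))` words of probability
about `exp (-n L(Q))`. A general stationary `Q` is approximated by irreducible ones, by mixing it
with the stationary pmf of the source itself (`exists_irreducible_near`), so that such words exist
for it too (`exists_typical`). They have total probability about `exp (-n D(η ‖ π ∣ q))`, and
half of them need at least half as many guesses as there are such words, whatever the order of the
guesses (`le_guessingMoment`). The same approximation shows that the supremum may be restricted to
irreducible `Q`.
-/

namespace GuessingLDP

variable {S X : Type*}

/-! ### Paths of states driven by a word -/

open Classical in
/-- The number of visits of the path driven by the word `x` to each pair (state, letter): the path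
starts in `s` and moves from a state `t` to `φ t a` when it reads the letter `a`. -/
noncomputable def pathCount (φ : S → X → S) : S → (n : ℕ) → (Fin n → X) → S × X → ℕ
  | _, 0, _, _ => 0
  | s, n + 1, x, p =>
    (if p = (s, x 0) then 1 else 0) + pathCount φ (φ s (x 0)) n (Fin.tail x) p

/-- The state in which the path driven by the word `x` ends. -/
def pathEnd (φ : S → X → S) : S → (n : ℕ) → (Fin n → X) → S
  | s, 0, _ => s
  | s, n + 1, x => pathEnd φ (φ s (x 0)) n (Fin.tail x)

lemma pathCount_le (φ : S → X → S) (s : S) (n : ℕ) (x : Fin n → X) (p : S × X) :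
    pathCount φ s n x p ≤ n := by
  induction n generalizing s with
  | zero => simp [pathCount]
  | succ n ih =>
    have := ih (φ s (x 0)) (Fin.tail x)
    rw [pathCount]
    split_ifs <;> omega

variable [Fintype S] [Fintype X]

/-- The sum of `f` over the pairs (state, letter) along the path driven by `x`. -/
noncomputable def pathSum (φ : S → X → S) (f : S × X → ℝ) (s : S) (n : ℕ) (x : Fin n → X) : ℝ :=
  ∑ p, (pathCount φ s n x p : ℝ) * f p

/-- The product of the weights `w` over the pairs (state, letter) along the path driven by `x`. -/
noncomputable def pathProd (φ : S → X → S) (w : S × X → ℝ) (s : S) (n : ℕ) (x : Fin n → X) : ℝ :=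
  ∏ p, w p ^ pathCount φ s n x p

/-- The empirical distribution of the pairs (state, letter) along the path driven by `x`. -/
noncomputable def empirical (φ : S → X → S) (s : S) (n : ℕ) (x : Fin n → X) (p : S × X) : ℝ :=
  (pathCount φ s n x p : ℝ) / n

lemma sum_fin_succ_arrow {α : Type*} [Fintype α] {M : Type*} [AddCommMonoid M] {n : ℕ}
    (F : (Fin (n + 1) → α) → M) :
    ∑ x, F x = ∑ a, ∑ y : Fin n → α, F (Fin.cons a y) := by
  rw [← Fintype.sum_prod_type' (f := fun a y => F (Fin.cons a y))]
  refine (Fintype.sum_equiv (Fin.insertNthEquiv (fun _ => α) 0) _ _ fun p => ?_).symm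
  simp [Fin.insertNthEquiv]

variable (φ : S → X → S)

@[simp] lemma pathSum_zero (f : S × X → ℝ) (s : S) (x : Fin 0 → X) : pathSum φ f s 0 x = 0 := by
  simp [pathSum, pathCount]

@[simp] lemma pathProd_zero (w : S × X → ℝ) (s : S) (x : Fin 0 → X) : pathProd φ w s 0 x = 1 := by
  simp [pathProd, pathCount]

@[simp] lemma pathSum_cons (f : S × X → ℝ) (s : S) (n : ℕ) (a : X) (y : Fin n → X) :
    pathSum φ f s (n + 1) (Fin.cons a y : Fin (n + 1) → X) =
      f (s, a) + pathSum φ f (φ s a) n y := by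
  simp [pathSum, pathCount, add_mul, Finset.sum_add_distrib]

@[simp] lemma pathProd_cons (w : S × X → ℝ) (s : S) (n : ℕ) (a : X) (y : Fin n → X) :
    pathProd φ w s (n + 1) (Fin.cons a y : Fin (n + 1) → X) =
      w (s, a) * pathProd φ w (φ s a) n y := by
  classical
  simp only [pathProd, pathCount, Fin.cons_zero, Fin.tail_cons, pow_add, Finset.prod_mul_distrib]
  congr 1
  rw [Finset.prod_eq_single (s, a)] <;> simp +contextual

lemma pathSum_one (s : S) (n : ℕ) (x : Fin n → X) : pathSum φ (fun _ => 1) s n x = n := by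
  induction n generalizing s with
  | zero => simp
  | succ n ih =>
    rw [← Fin.cons_self_tail x, pathSum_cons, ih]
    push_cast; ring

/-- The increments of a function of the state telescope along a path. -/
lemma pathSum_coboundary (g : S → ℝ) (s : S) (n : ℕ) (x : Fin n → X) :
    pathSum φ (fun p => g (φ p.1 p.2) - g p.1) s n x = g (pathEnd φ s n x) - g s := by
  induction n generalizing s with
  | zero => simp [pathEnd]
  | succ n ih =>
    conv_lhs => rw [← Fin.cons_self_tail x, pathSum_cons, ih]
    simp [pathEnd]

lemma pathSum_add (f g : S × X → ℝ) (s : S) (n : ℕ) (x : Fin n → X) :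
    pathSum φ (fun p => f p + g p) s n x = pathSum φ f s n x + pathSum φ g s n x := by
  simp [pathSum, mul_add, Finset.sum_add_distrib]

lemma pathSum_const_mul (c : ℝ) (f : S × X → ℝ) (s : S) (n : ℕ) (x : Fin n → X) :
    pathSum φ (fun p => c * f p) s n x = c * pathSum φ f s n x := by
  simp only [pathSum, Finset.mul_sum]
  exact Finset.sum_congr rfl fun p _ => by ring

lemma pathSum_eq_mul_empirical (f : S × X → ℝ) (s : S) {n : ℕ} (hn : n ≠ 0) (x : Fin n → X) :
    pathSum φ f s n x = n * ∑ p, empirical φ s n x p * f p := by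
  have : (n : ℝ) ≠ 0 := by exact_mod_cast hn
  simp only [pathSum, empirical, Finset.mul_sum]
  exact Finset.sum_congr rfl fun p _ => by field_simp

lemma empirical_mem_stdSimplex (s : S) {n : ℕ} (hn : n ≠ 0) (x : Fin n → X) :
    empirical φ s n x ∈ stdSimplex ℝ (S × X) := by
  have h0 : (n : ℝ) ≠ 0 := by exact_mod_cast hn
  refine ⟨fun p => by unfold empirical; positivity, ?_⟩
  have := pathSum_one φ s n x
  rw [pathSum_eq_mul_empirical φ _ s hn] at this
  simpa [h0] using this

lemma pathProd_nonneg {w : S × X → ℝ} (hw : ∀ p, 0 ≤ w p) (s : S) (n : ℕ) (x : Fin n → X) :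
    0 ≤ pathProd φ w s n x :=
  Finset.prod_nonneg fun p _ => pow_nonneg (hw p) _

lemma pathProd_eq_exp {w : S × X → ℝ} (s : S) (n : ℕ) (x : Fin n → X)
    (hw : ∀ p, pathCount φ s n x p ≠ 0 → 0 < w p) :
    pathProd φ w s n x = Real.exp (pathSum φ (fun p => Real.log (w p)) s n x) := by
  rw [pathSum, Real.exp_sum, pathProd]
  refine Finset.prod_congr rfl fun p _ => ?_
  by_cases h : pathCount φ s n x p = 0
  · simp [h]
  · rw [Real.exp_nat_mul, Real.exp_log (hw p h)]

lemma ne_zero_of_pathProd_ne_zero {w : S × X → ℝ} {s : S} {n : ℕ} {x : Fin n → X}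
    (h : pathProd φ w s n x ≠ 0) {p : S × X} (hp : pathCount φ s n x p ≠ 0) : w p ≠ 0 := by
  intro h0
  exact Finset.prod_ne_zero_iff.1 h p (Finset.mem_univ p) (by rw [h0, zero_pow hp])

lemma sum_pathProd {w : S × X → ℝ} (hw : ∀ s, ∑ x, w (s, x) = 1) (s : S) (n : ℕ) :
    ∑ x : Fin n → X, pathProd φ w s n x = 1 := by
  induction n generalizing s with
  | zero => simp
  | succ n ih => simp [sum_fin_succ_arrow, ← Finset.mul_sum, ih, hw]

/-- The second moment of a sum of increments that have mean zero in each state grows at most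
linearly in the length of the word. -/
lemma sum_pathProd_mul_sq_le {w : S × X → ℝ} (hw0 : ∀ p, 0 ≤ w p) (hw : ∀ s, ∑ x, w (s, x) = 1)
    {h : S × X → ℝ} (hh : ∀ s, ∑ x, w (s, x) * h (s, x) = 0) {C : ℝ}
    (hC : ∀ p, h p ^ 2 ≤ C) (s : S) (n : ℕ) (c : ℝ) :
    ∑ x : Fin n → X, pathProd φ w s n x * (c + pathSum φ h s n x) ^ 2 ≤ c ^ 2 + n * C := by
  induction n generalizing s c with
  | zero => simp
  | succ n ih =>
    calc ∑ x : Fin (n + 1) → X, pathProd φ w s (n + 1) x * (c + pathSum φ h s (n + 1) x) ^ 2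
        = ∑ a, w (s, a) * ∑ y : Fin n → X,
            pathProd φ w (φ s a) n y * ((c + h (s, a)) + pathSum φ h (φ s a) n y) ^ 2 := by
          simp [sum_fin_succ_arrow, Finset.mul_sum, mul_assoc, add_assoc]
      _ ≤ ∑ a, w (s, a) * ((c + h (s, a)) ^ 2 + n * C) :=
          Finset.sum_le_sum fun a _ => mul_le_mul_of_nonneg_left (ih _ _) (hw0 _)
      _ ≤ ∑ a, (w (s, a) * (c ^ 2 + n * C + C) + 2 * c * (w (s, a) * h (s, a))) :=
          Finset.sum_le_sum fun a _ => by
            nlinarith [mul_le_mul_of_nonneg_left (hC (s, a)) (hw0 (s, a))]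
      _ = c ^ 2 + (n + 1 : ℕ) * C := by
          rw [Finset.sum_add_distrib, ← Finset.sum_mul, ← Finset.mul_sum, hw, hh]
          push_cast; ring

/-! ### The probability of a word -/

namespace UnifilarSource

variable (U : UnifilarSource S X)

/-- The letter probabilities as weights on pairs (state, letter). -/
noncomputable def weight (p : S × X) : ℝ := U.letterProb p.1 p.2

lemma pi_nonneg (s : S) (p : X × S) : 0 ≤ U.π s p := (U.π_mem s).1 p

lemma weight_nonneg (p : S × X) : 0 ≤ U.weight p := Finset.sum_nonneg fun _ _ => U.pi_nonneg _ _

lemma sum_weight (s : S) : ∑ x, U.weight (s, x) = 1 := by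
  have := (U.π_mem s).2
  rwa [Fintype.sum_prod_type] at this

open Classical in
lemma pi_eq (s : S) (x : X) (s' : S) :
    U.π s (x, s') = if U.φ s x = s' then U.weight (s, x) else 0 := by
  have h0 : ∀ t, t ≠ U.φ s x → U.π s (x, t) = 0 := fun t ht => by
    by_contra h
    exact ht (U.eq_φ s x t h)
  split_ifs with h
  · subst h
    exact (Finset.sum_eq_single _ (fun t _ ht => h0 t ht) (by simp)).symm
  · exact h0 _ fun h' => h h'.symm

lemma prob_cons (s : S) (n : ℕ) (a : X) (y : Fin n → X) :
    U.prob s (n + 1) (Fin.cons a y : Fin (n + 1) → X) = ∑ s', U.π s (a, s') * U.prob s' n y := by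
  simp only [prob, sum_fin_succ_arrow, Finset.mul_sum]
  refine Finset.sum_congr rfl fun s' _ => Finset.sum_congr rfl fun t _ => ?_
  simp [jointProb, Fin.prod_univ_succ]

/-- Since the path of states is determined by the word, `P_n(x)` is a product along that path. -/
lemma prob_eq_pathProd (s : S) (n : ℕ) (x : Fin n → X) :
    U.prob s n x = pathProd U.φ U.weight s n x := by
  induction n generalizing s with
  | zero => simp [prob, jointProb]
  | succ n ih =>
    rw [← Fin.cons_self_tail x, prob_cons, pathProd_cons]
    classical
    simp [pi_eq, ih]

lemma prob_nonneg (s : S) (n : ℕ) (x : Fin n → X) : 0 ≤ U.prob s n x := by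
  rw [prob_eq_pathProd]
  exact pathProd_nonneg _ U.weight_nonneg _ _ _

lemma sum_prob (s : S) (n : ℕ) : ∑ x, U.prob s n x = 1 := by
  simp_rw [prob_eq_pathProd]
  exact sum_pathProd _ U.sum_weight s n

end UnifilarSource

end GuessingLDP

namespace GuessingLDP

variable {S X : Type*} [Fintype X]

/-! ### Conditional entropy and conditional relative entropy -/

lemma condLetter_nonneg {Q : S × X → ℝ} (hQ : ∀ p, 0 ≤ Q p) (s : S) (x : X) :
    0 ≤ condLetter Q s x := by
  have : 0 ≤ stateMarginal Q s := Finset.sum_nonneg fun _ _ => hQ _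
  unfold condLetter
  split_ifs
  · exact div_nonneg (hQ _) this
  · positivity

lemma sum_condLetter [Nonempty X] (Q : S × X → ℝ) (s : S) : ∑ x, condLetter Q s x = 1 := by
  by_cases h : stateMarginal Q s = 0
  · simp [condLetter, h]
  · simp only [condLetter, h, ne_eq, not_false_eq_true, if_true, ← Finset.sum_div]
    exact div_self h

lemma eq_zero_of_stateMarginal_eq_zero {Q : S × X → ℝ} (hQ : ∀ p, 0 ≤ Q p) {s : S}
    (h : stateMarginal Q s = 0) (x : X) : Q (s, x) = 0 :=
  (Finset.sum_eq_zero_iff_of_nonneg fun x _ => hQ (s, x)).1 h x (Finset.mem_univ x)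

lemma stateMarginal_mul_condLetter {Q : S × X → ℝ} (hQ : ∀ p, 0 ≤ Q p) (s : S) (x : X) :
    stateMarginal Q s * condLetter Q s x = Q (s, x) := by
  by_cases h : stateMarginal Q s = 0
  · simp [h, eq_zero_of_stateMarginal_eq_zero hQ h]
  · simp [condLetter, h, mul_div_cancel₀]

lemma continuous_stateMarginal : Continuous (stateMarginal : (S × X → ℝ) → S → ℝ) :=
  continuous_pi fun _ => continuous_finsetSum _ fun _ _ => continuous_apply _

variable [Fintype S]

lemma condEntropy_eq_neg_sum {Q : S × X → ℝ} (hQ : ∀ p, 0 ≤ Q p) :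
    condEntropy Q = -∑ p : S × X, Q p * Real.log (condLetter Q p.1 p.2) := by
  rw [Fintype.sum_prod_type, condEntropy, ← Finset.sum_neg_distrib]
  refine Finset.sum_congr rfl fun s _ => ?_
  rw [entropy, Finset.mul_sum, ← Finset.sum_neg_distrib]
  refine Finset.sum_congr rfl fun x _ => ?_
  rw [← stateMarginal_mul_condLetter hQ s x, Real.negMulLog]
  ring

/-- The chain rule `H(η ∣ q) = H(Q) - H(q)`. -/
lemma condEntropy_eq_sub {Q : S × X → ℝ} (hQ : ∀ p, 0 ≤ Q p) :
    condEntropy Q = entropy Q - entropy (stateMarginal Q) := by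
  rw [condEntropy_eq_neg_sum hQ, entropy, entropy, Fintype.sum_prod_type, Fintype.sum_prod_type,
    ← Finset.sum_neg_distrib, ← Finset.sum_sub_distrib]
  refine Finset.sum_congr rfl fun s _ => ?_
  have h1 : Real.negMulLog (stateMarginal Q s) =
      ∑ x, -(Q (s, x) * Real.log (stateMarginal Q s)) := by
    rw [Finset.sum_neg_distrib, ← Finset.sum_mul, Real.negMulLog, stateMarginal, neg_mul]
  rw [h1, ← Finset.sum_neg_distrib, ← Finset.sum_sub_distrib]
  refine Finset.sum_congr rfl fun x _ => ?_
  by_cases hx : Q (s, x) = 0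
  · simp [hx]
  · have hs : stateMarginal Q s ≠ 0 := fun h => hx (eq_zero_of_stateMarginal_eq_zero hQ h x)
    simp only [condLetter, hs, ne_eq, not_false_eq_true, if_true, Real.log_div hx hs,
      Real.negMulLog]
    ring

lemma continuous_entropy {α : Type*} [Fintype α] : Continuous (entropy : (α → ℝ) → ℝ) :=
  continuous_finsetSum _ fun a _ => Real.continuous_negMulLog.comp (continuous_apply a)

lemma continuousOn_condEntropy :
    ContinuousOn (condEntropy : (S × X → ℝ) → ℝ) (stdSimplex ℝ (S × X)) :=
  (continuous_entropy.sub (continuous_entropy.comp continuous_stateMarginal)).continuousOn.congr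
    fun _ hQ => condEntropy_eq_sub hQ.1

/-- Gibbs' inequality. -/
lemma relEntropy_nonneg {α : Type*} [Fintype α] {p r : α → ℝ} (hp : ∀ a, 0 ≤ p a)
    (hr : ∀ a, 0 ≤ r a) (h : ∑ a, r a ≤ ∑ a, p a) : 0 ≤ relEntropy p r := by
  unfold relEntropy
  split_ifs with hac
  · rw [EReal.coe_nonneg]
    refine (sub_nonneg.2 h).trans ?_
    rw [← Finset.sum_sub_distrib]
    refine Finset.sum_le_sum fun a _ => ?_
    rcases (hp a).eq_or_lt with h0 | h0
    · simpa [← h0] using hr a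
    · have hra : 0 < r a := (hr a).lt_of_ne fun h' => h0.ne' (hac a h'.symm)
      have := Real.one_sub_inv_le_log_of_pos (div_pos h0 hra)
      calc p a - r a = p a * (1 - (p a / r a)⁻¹) := by field_simp
        _ ≤ _ := mul_le_mul_of_nonneg_left this h0.le
  · exact le_top

namespace UnifilarSource

/-- `Q` charges only pairs (state, letter) of positive probability. -/
def AbsCont (U : UnifilarSource S X) (Q : S × X → ℝ) : Prop :=
  ∀ s x, U.letterProb s x = 0 → Q (s, x) = 0

/-- The mean `∑ Q(s, x) ln (1 / π(x ∣ s))` of the information of a letter. -/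
noncomputable def meanInfo (U : UnifilarSource S X) (Q : S × X → ℝ) : ℝ :=
  ∑ s, ∑ x, Q (s, x) * Real.log (1 / U.letterProb s x)

variable (U : UnifilarSource S X)

lemma meanInfo_eq (Q : S × X → ℝ) : U.meanInfo Q = -∑ p, Q p * Real.log (U.weight p) := by
  simp [meanInfo, weight, Fintype.sum_prod_type, Real.log_inv]

lemma continuous_meanInfo : Continuous U.meanInfo := by
  unfold meanInfo; fun_prop

lemma isClosed_absCont : IsClosed {Q | U.AbsCont Q} := by
  simp only [AbsCont, Set.ofPred_forall]
  exact isClosed_iInter fun s => isClosed_iInter fun x => isClosed_iInter fun _ =>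
    isClosed_eq (continuous_apply _) continuous_const

lemma nonempty_letter (U : UnifilarSource S X) (s : S) : Nonempty X := by
  by_contra h
  rw [not_nonempty_iff] at h
  simpa using U.sum_weight s

lemma relEntropy_condLetter_nonneg {Q : S × X → ℝ} (hQ : ∀ p, 0 ≤ Q p) (s : S) :
    0 ≤ relEntropy (condLetter Q s) (U.letterProb s) := by
  have := U.nonempty_letter s
  refine relEntropy_nonneg (condLetter_nonneg hQ s) (fun x => U.weight_nonneg (s, x)) ?_
  rw [sum_condLetter]
  exact (U.sum_weight s).le

lemma condRelEntropy_nonneg {Q : S × X → ℝ} (hQ : ∀ p, 0 ≤ Q p) : 0 ≤ U.condRelEntropy Q :=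
  Finset.sum_nonneg fun s _ => mul_nonneg
    (EReal.coe_nonneg.2 (Finset.sum_nonneg fun _ _ => hQ _)) (U.relEntropy_condLetter_nonneg hQ s)

/-- On the pmfs that charge only pairs of positive probability, `D(η ‖ π ∣ q)` is the difference of
a linear function and the conditional entropy. -/
lemma condRelEntropy_eq {Q : S × X → ℝ} (hQ : ∀ p, 0 ≤ Q p) (hac : U.AbsCont Q) :
    U.condRelEntropy Q = ((U.meanInfo Q - condEntropy Q : ℝ) : EReal) := by
  have key : ∀ s, (stateMarginal Q s : EReal) * relEntropy (condLetter Q s) (U.letterProb s) =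
      ((∑ x, (Q (s, x) * Real.log (condLetter Q s x) -
        Q (s, x) * Real.log (U.letterProb s x)) : ℝ) : EReal) := fun s => by
    by_cases hs : stateMarginal Q s = 0
    · simp [hs, eq_zero_of_stateMarginal_eq_zero hQ hs]
    · have h0 : ∀ x, U.letterProb s x = 0 → condLetter Q s x = 0 := fun x hx => by
        simp [condLetter, hs, hac s x hx]
      rw [relEntropy, if_pos h0, ← EReal.coe_mul, Finset.mul_sum]
      congr 1
      refine Finset.sum_congr rfl fun x _ => ?_
      rw [← mul_assoc, stateMarginal_mul_condLetter hQ]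
      by_cases hx : Q (s, x) = 0
      · simp [hx]
      · have h1 : condLetter Q s x ≠ 0 := fun h => hx (by
          rw [← stateMarginal_mul_condLetter hQ, h, mul_zero])
        rw [Real.log_div h1 fun h => hx (hac s x h)]
        ring
  have hsum : ∀ f : S → ℝ, ((∑ s, f s : ℝ) : EReal) = ∑ s, (f s : EReal) := fun f =>
    map_sum (⟨⟨Real.toEReal, EReal.coe_zero⟩, EReal.coe_add⟩ : ℝ →+ EReal) f Finset.univ
  rw [condRelEntropy, Finset.sum_congr rfl fun s _ => key s, ← hsum,
    condEntropy_eq_neg_sum hQ, meanInfo_eq, Fintype.sum_prod_type, Fintype.sum_prod_type]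
  congr 1
  simp only [Finset.sum_sub_distrib, weight]
  ring

lemma condRelEntropy_eq_top {Q : S × X → ℝ} (hQ : ∀ p, 0 ≤ Q p) (hac : ¬ U.AbsCont Q) :
    U.condRelEntropy Q = ⊤ := by
  classical
  simp only [AbsCont, not_forall] at hac
  obtain ⟨s, x, hx, hne⟩ := hac
  have hs : stateMarginal Q s ≠ 0 := fun h => hne (eq_zero_of_stateMarginal_eq_zero hQ h x)
  have hs0 : 0 < stateMarginal Q s := (Finset.sum_nonneg fun _ _ => hQ _).lt_of_ne hs.symm
  have htop : relEntropy (condLetter Q s) (U.letterProb s) = ⊤ := by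
    refine if_neg fun h => hne ?_
    rw [← stateMarginal_mul_condLetter hQ, h x hx, mul_zero]
  have hrest : 0 ≤ ∑ t ∈ Finset.univ.erase s,
      (stateMarginal Q t : EReal) * relEntropy (condLetter Q t) (U.letterProb t) :=
    Finset.sum_nonneg fun t _ => mul_nonneg
      (EReal.coe_nonneg.2 (Finset.sum_nonneg fun _ _ => hQ _)) (U.relEntropy_condLetter_nonneg hQ t)
  rw [condRelEntropy, ← Finset.add_sum_erase _ _ (Finset.mem_univ s), htop,
    EReal.coe_mul_top_of_pos hs0, EReal.top_add_of_ne_bot]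
  exact fun h => by simp [h] at hrest

end UnifilarSource

end GuessingLDP

namespace GuessingLDP

variable {S X : Type*} [Fintype S] [Fintype X]

/-! ### Counting words by their empirical distribution -/

open Classical in
/-- A class of words with a common empirical distribution `Q = q × η` has at most
`exp (n H(η ∣ q))` elements: each of them has probability `exp (-n H(η ∣ q))` when letters are drawn
by `η`. -/
lemma card_pathCount_eq_le [Nonempty X] (φ : S → X → S) (s : S) {n : ℕ} (hn : n ≠ 0)
    (x₀ : Fin n → X) :
    ((Finset.univ.filter fun x => pathCount φ s n x = pathCount φ s n x₀).card : ℝ) ≤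
      Real.exp (n * condEntropy (empirical φ s n x₀)) := by
  have hn0 : (0 : ℝ) < n := by positivity
  set T := empirical φ s n x₀ with hT
  have hT0 : ∀ p, 0 ≤ T p := (empirical_mem_stdSimplex φ s hn x₀).1
  set w : S × X → ℝ := fun p => condLetter T p.1 p.2 with hw
  have hpos : ∀ p, pathCount φ s n x₀ p ≠ 0 → 0 < w p := fun p hp => by
    refine (condLetter_nonneg hT0 _ _).lt_of_ne fun h => ?_
    have h1 := stateMarginal_mul_condLetter hT0 p.1 p.2
    rw [← h, mul_zero, hT] at h1
    have h2 : (pathCount φ s n x₀ p : ℝ) / n = 0 := h1.symm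
    simp [hn, hp] at h2
  have hprod : ∀ x, pathCount φ s n x = pathCount φ s n x₀ →
      pathProd φ w s n x = Real.exp (-(n * condEntropy T)) := fun x hx => by
    have : pathProd φ w s n x = pathProd φ w s n x₀ := by simp only [pathProd, hx]
    rw [this, pathProd_eq_exp φ s n x₀ hpos, pathSum_eq_mul_empirical φ _ s hn,
      condEntropy_eq_neg_sum hT0]
    simp [hT, hw]
  have hle : ∑ x ∈ Finset.univ.filter fun x => pathCount φ s n x = pathCount φ s n x₀,
      pathProd φ w s n x ≤ 1 := by
    rw [← sum_pathProd φ (w := w) (sum_condLetter T) s n]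
    exact Finset.sum_le_sum_of_subset_of_nonneg (Finset.subset_univ _) fun x _ _ =>
      pathProd_nonneg φ (fun p => condLetter_nonneg hT0 _ _) s n x
  rw [Finset.sum_congr rfl fun x hx => hprod x (Finset.mem_filter.1 hx).2, Finset.sum_const,
    nsmul_eq_mul, Real.exp_neg, ← div_eq_mul_inv, div_le_one (Real.exp_pos _)] at hle
  exact hle

open Classical in
/-- There are only polynomially many empirical distributions, so that an exponential sum over words
is governed by its largest class. -/
lemma sum_exp_empirical_le [Nonempty X] (φ : S → X → S) (s : S) {n : ℕ} (hn : n ≠ 0)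
    (B : Set (S × X → ℝ)) (ψ : (S × X → ℝ) → ℝ) {a : ℝ}
    (hB : ∀ x, empirical φ s n x ∈ B →
      condEntropy (empirical φ s n x) - ψ (empirical φ s n x) ≤ a) :
    ∑ x ∈ Finset.univ.filter fun x => empirical φ s n x ∈ B,
        Real.exp (-(n * ψ (empirical φ s n x))) ≤
      ((n : ℝ) + 1) ^ Fintype.card (S × X) * Real.exp (n * a) := by
  have hmaps : ∀ x ∈ Finset.univ.filter fun x => empirical φ s n x ∈ B,
      pathCount φ s n x ∈ Fintype.piFinset fun _ : S × X => Finset.range (n + 1) := fun x _ => by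
    simpa [Fintype.mem_piFinset, Nat.lt_succ_iff] using pathCount_le φ s n x
  have hcard : ((Fintype.piFinset fun _ : S × X => Finset.range (n + 1)).card : ℝ) =
      ((n : ℝ) + 1) ^ Fintype.card (S × X) := by
    simp [Fintype.card_piFinset]
  rw [← Finset.sum_fiberwise_of_maps_to hmaps, ← hcard, ← nsmul_eq_mul]
  refine Finset.sum_le_card_nsmul _ _ _ fun c _ => ?_
  rcases Finset.eq_empty_or_nonempty ((Finset.univ.filter fun x => empirical φ s n x ∈ B).filter
    fun x => pathCount φ s n x = c) with h | ⟨x₀, hx₀⟩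
  · rw [h, Finset.sum_empty]; positivity
  · simp only [Finset.mem_filter, Finset.mem_univ, true_and] at hx₀
    obtain ⟨hxB, rfl⟩ := hx₀
    have hemp : ∀ x, pathCount φ s n x = pathCount φ s n x₀ →
        empirical φ s n x = empirical φ s n x₀ := fun x hx => by
      funext p; simp only [empirical, hx]
    calc _ = ∑ x ∈ (Finset.univ.filter fun x => empirical φ s n x ∈ B).filter
            fun x => pathCount φ s n x = pathCount φ s n x₀,
            Real.exp (-(n * ψ (empirical φ s n x₀))) :=
          Finset.sum_congr rfl fun x hx => by rw [hemp x (Finset.mem_filter.1 hx).2]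
      _ ≤ ∑ x ∈ Finset.univ.filter fun x => pathCount φ s n x = pathCount φ s n x₀,
            Real.exp (-(n * ψ (empirical φ s n x₀))) :=
          Finset.sum_le_sum_of_subset_of_nonneg
            (Finset.filter_subset_filter _ (Finset.subset_univ _)) fun _ _ _ => (Real.exp_pos _).le
      _ ≤ Real.exp (n * condEntropy (empirical φ s n x₀)) *
            Real.exp (-(n * ψ (empirical φ s n x₀))) := by
          rw [Finset.sum_const, nsmul_eq_mul]
          exact mul_le_mul_of_nonneg_right (card_pathCount_eq_le φ s hn x₀) (Real.exp_pos _).le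
      _ ≤ Real.exp (n * a) := by
          rw [← Real.exp_add]
          refine Real.exp_le_exp.2 ?_
          have := mul_le_mul_of_nonneg_left (hB x₀ hxB) (Nat.cast_nonneg (α := ℝ) n)
          linarith

/-! ### Stationarity in the limit -/

open Classical in
/-- The amount by which `Q` fails to be stationary at the state `s'`. -/
noncomputable def stationarityDefect (φ : S → X → S) (Q : S × X → ℝ) (s' : S) : ℝ :=
  (∑ s, ∑ x, if φ s x = s' then Q (s, x) else 0) - stateMarginal Q s'

lemma mem_stationaryPmfs_iff {φ : S → X → S} {Q : S × X → ℝ} :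
    Q ∈ stationaryPmfs φ ↔ Q ∈ stdSimplex ℝ (S × X) ∧ ∀ s', stationarityDefect φ Q s' = 0 := by
  simp [stationaryPmfs, stationarityDefect, sub_eq_zero]

lemma continuous_stationarityDefect (φ : S → X → S) (s' : S) :
    Continuous fun Q : S × X → ℝ => stationarityDefect φ Q s' := by
  unfold stationarityDefect
  refine Continuous.sub (continuous_finsetSum _ fun s _ => continuous_finsetSum _ fun x _ => ?_)
    ((continuous_apply s').comp continuous_stateMarginal)
  split_ifs
  · exact continuous_apply _
  · exact continuous_const

/-- The integral of a function `g` of the state against the defect is the mean increment of `g`. -/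
lemma sum_mul_stationarityDefect (φ : S → X → S) (Q : S × X → ℝ) (g : S → ℝ) :
    ∑ s', stationarityDefect φ Q s' * g s' = ∑ p, Q p * (g (φ p.1 p.2) - g p.1) := by
  classical
  simp only [stationarityDefect, sub_mul, mul_sub, Finset.sum_sub_distrib, Finset.sum_mul,
    stateMarginal, Fintype.sum_prod_type]
  congr 1
  rw [Finset.sum_comm]
  refine Finset.sum_congr rfl fun s _ => ?_
  rw [Finset.sum_comm]
  simp

/-- An empirical distribution is stationary up to the contribution of the two ends of the path. -/
lemma abs_stationarityDefect_empirical_le (φ : S → X → S) (s : S) {n : ℕ} (hn : n ≠ 0)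
    (x : Fin n → X) (s' : S) : |stationarityDefect φ (empirical φ s n x) s'| ≤ 1 / n := by
  classical
  have hn0 : (0 : ℝ) < n := by positivity
  have h1 := pathSum_coboundary φ (fun t => if t = s' then (1 : ℝ) else 0) s n x
  rw [pathSum_eq_mul_empirical φ _ s hn,
    ← sum_mul_stationarityDefect φ _ (fun t => if t = s' then (1 : ℝ) else 0)] at h1
  simp only [mul_ite, mul_one, mul_zero, Finset.sum_ite_eq', Finset.mem_univ, if_true] at h1
  rw [le_div_iff₀' hn0, ← abs_of_pos hn0, ← abs_mul, h1]
  split_ifs <;> simp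

lemma isCompact_stationaryPmfs (φ : S → X → S) : IsCompact (stationaryPmfs φ) := by
  have : stationaryPmfs φ =
      stdSimplex ℝ (S × X) ∩ ⋂ s', {Q | stationarityDefect φ Q s' = 0} := by
    ext Q; simp [mem_stationaryPmfs_iff]
  rw [this]
  exact (isCompact_stdSimplex ℝ (S × X)).inter_right
    (isClosed_iInter fun s' => isClosed_eq (continuous_stationarityDefect φ s') continuous_const)

/-- A strict upper bound for a continuous function at the stationary pmfs of a closed set holds at
the empirical distributions of all long words: by compactness, the pmfs of the closed set that
violate it have a stationarity defect bounded away from zero. -/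
lemma eventually_empirical_lt (φ : S → X → S) {B : Set (S × X → ℝ)} (hB : IsClosed B)
    {F : (S × X → ℝ) → ℝ} (hF : ContinuousOn F (stdSimplex ℝ (S × X))) {a : ℝ}
    (h : ∀ Q ∈ stationaryPmfs φ, Q ∈ B → F Q < a) :
    ∀ᶠ n : ℕ in atTop, ∀ s (x : Fin n → X),
      empirical φ s n x ∈ B → F (empirical φ s n x) < a := by
  -- The compact set of pmfs in `B` that violate the bound.
  set C := B ∩ (stdSimplex ℝ (S × X) ∩ F ⁻¹' Set.Ici a) with hC
  have hCc : IsCompact C := by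
    refine IsCompact.inter_left ?_ hB
    exact (isCompact_stdSimplex ℝ (S × X)).of_isClosed_subset
      (hF.preimage_isClosed_of_isClosed (isClosed_stdSimplex ℝ (S × X)) isClosed_Ici)
      Set.inter_subset_left
  set d : (S × X → ℝ) → ℝ := fun Q => ∑ s', |stationarityDefect φ Q s'| with hd
  have hdc : Continuous d :=
    continuous_finsetSum _ fun s' _ => (continuous_stationarityDefect φ s').abs
  have hpos : ∀ Q ∈ C, 0 < d Q := fun Q hQ => by
    refine (Finset.sum_nonneg fun _ _ => abs_nonneg _).lt_of_ne fun h0 => ?_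
    refine (h Q (mem_stationaryPmfs_iff.2 ⟨hQ.2.1, fun s' => ?_⟩) hQ.1).not_ge hQ.2.2
    exact abs_eq_zero.1
      ((Finset.sum_eq_zero_iff_of_nonneg fun _ _ => abs_nonneg _).1 h0.symm s' (Finset.mem_univ _))
  obtain ⟨δ, hδ, hδC⟩ : ∃ δ > 0, ∀ Q ∈ C, δ ≤ d Q := by
    rcases C.eq_empty_or_nonempty with h0 | hne
    · exact ⟨1, one_pos, by simp [h0]⟩
    · obtain ⟨Q, hQ, hmin⟩ := hCc.exists_isMinOn hne hdc.continuousOn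
      exact ⟨d Q, hpos Q hQ, fun Q' hQ' => hmin hQ'⟩
  have hlim : Tendsto (fun n : ℕ => (Fintype.card S : ℝ) / n) atTop (𝓝 0) :=
    tendsto_const_div_atTop_nhds_zero_nat _
  filter_upwards [hlim.eventually (gt_mem_nhds hδ), eventually_ne_atTop 0] with n hn hn0 s x hx
  by_contra! hge
  have h1 := hδC _ ⟨hx, empirical_mem_stdSimplex φ s hn0 x, hge⟩
  have h2 : d (empirical φ s n x) ≤ Fintype.card S / n := by
    calc _ ≤ ∑ _s' : S, 1 / (n : ℝ) :=
          Finset.sum_le_sum fun s' _ => abs_stationarityDefect_empirical_le φ s hn0 x s'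
      _ = _ := by simp [div_eq_mul_inv]
  linarith

end GuessingLDP

namespace GuessingLDP

variable {S X : Type*}

/-! ### Irreducible stochastic matrices -/

/-- A property that holds at one state and passes along the edges of an irreducible matrix holds at
every state. -/
lemma forall_of_isIrreducible {A : Matrix S S ℝ} (hA : A.IsIrreducible) {p : S → Prop} {i : S}
    (hi : p i) (h : ∀ a b, 0 < A a b → p a → p b) (j : S) : p j := by
  let : Quiver S := A.toQuiver
  obtain ⟨w, -⟩ := hA.connected i j
  induction w with
  | nil => exact hi
  | cons _ e ih => exact h _ _ e.down ih

lemma isIrreducible_mono {A B : Matrix S S ℝ} (hA : A.IsIrreducible) (hB : ∀ i j, 0 ≤ B i j)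
    (h : ∀ i j, 0 < A i j → 0 < B i j) : B.IsIrreducible := by
  refine ⟨hB, fun i j => ?_⟩
  obtain ⟨w, hw⟩ := @hA.connected i j
  suffices H : ∀ {k} (w : @Quiver.Path S A.toQuiver i k),
      ∃ v : @Quiver.Path S B.toQuiver i k,
        @Quiver.Path.length S B.toQuiver i k v = @Quiver.Path.length S A.toQuiver i k w by
    obtain ⟨v, hv⟩ := H w
    exact ⟨v, hv ▸ hw⟩
  intro k w
  induction w with
  | nil => exact ⟨@Quiver.Path.nil S B.toQuiver i, rfl⟩
  | @cons b c w e ih =>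
    obtain ⟨v, hv⟩ := ih
    exact ⟨@Quiver.Path.cons S B.toQuiver i b c v ⟨h _ _ e.down⟩, congrArg (· + 1) hv⟩

variable [Fintype S]

lemma pos_of_stationary {A : Matrix S S ℝ} (hA : A.IsIrreducible) {q : S → ℝ} (hq : ∀ s, 0 ≤ q s)
    (hq1 : ∑ s, q s = 1) (hst : ∀ s', ∑ s, q s * A s s' = q s') (s : S) : 0 < q s := by
  obtain ⟨i, hi⟩ : ∃ i, 0 < q i := by
    by_contra! h
    linarith [Finset.sum_nonpos fun s (_ : s ∈ Finset.univ) => h s]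
  refine forall_of_isIrreducible hA (p := fun s => 0 < q s) hi (fun a b hab ha => ?_) s
  rw [← hst b]
  exact Finset.sum_pos' (fun s _ => mul_nonneg (hq s) (hA.nonneg _ _))
    ⟨a, Finset.mem_univ a, mul_pos ha hab⟩

/-- The maximum principle: a harmonic function of an irreducible chain is constant. -/
lemma eq_of_harmonic {A : Matrix S S ℝ} (hA : A.IsIrreducible) (hrow : ∀ s, ∑ s', A s s' = 1)
    {g : S → ℝ} (hg : ∀ s, ∑ s', A s s' * g s' = g s) (s t : S) : g s = g t := by
  have : Nonempty S := ⟨s⟩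
  obtain ⟨m, hm⟩ := Finite.exists_max g
  have key : ∀ j, g j = g m := forall_of_isIrreducible hA rfl fun a b hab ha => by
    have h0 : ∑ s', A a s' * (g m - g s') = 0 := by
      simp only [mul_sub, Finset.sum_sub_distrib, ← Finset.sum_mul, hrow, hg, ha]
      ring
    have h1 := (Finset.sum_eq_zero_iff_of_nonneg fun s' _ =>
      mul_nonneg (hA.nonneg a s') (sub_nonneg.2 (hm s'))).1 h0 b (Finset.mem_univ b)
    rcases mul_eq_zero.1 h1 with h | h
    · exact absurd h hab.ne'
    · linarith
  rw [key s, key t]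

/-- An irreducible stochastic matrix has a stationary pmf: the absolute value of a left eigenvector
for the eigenvalue `1` is again such an eigenvector. -/
lemma exists_stationary [Nonempty S] {A : Matrix S S ℝ} (hA : A.IsIrreducible)
    (hrow : ∀ s, ∑ s', A s s' = 1) :
    ∃ q : S → ℝ, (∀ s, 0 < q s) ∧ ∑ s, q s = 1 ∧ ∀ s', ∑ s, q s * A s s' = q s' := by
  classical
  have hdet : (1 - A).det = 0 := by
    rw [← Matrix.exists_mulVec_eq_zero_iff]
    refine ⟨1, one_ne_zero, ?_⟩
    funext s
    rw [Matrix.sub_mulVec, Matrix.one_mulVec]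
    simp [Matrix.mulVec, dotProduct, hrow]
  obtain ⟨v, hv0, hv⟩ := Matrix.exists_vecMul_eq_zero_iff.2 hdet
  have hv1 : ∀ s', ∑ s, v s * A s s' = v s' := fun s' => by
    have := congrFun hv s'
    simp only [Matrix.vecMul_sub, Matrix.vecMul_one, Pi.sub_apply, Pi.zero_apply] at this
    simp only [Matrix.vecMul, dotProduct] at this
    linarith
  -- Both sides have the same sum over `s'`, so that equality holds throughout.
  have hle : ∀ s', |v s'| ≤ ∑ s, |v s| * A s s' := fun s' => by
    rw [← hv1 s']
    refine (Finset.abs_sum_le_sum_abs _ _).trans_eq (Finset.sum_congr rfl fun s _ => ?_)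
    rw [abs_mul, abs_of_nonneg (hA.nonneg s s')]
  have hsum : ∑ s', |v s'| = ∑ s', ∑ s, |v s| * A s s' := by
    rw [Finset.sum_comm]
    simp [← Finset.mul_sum, hrow]
  have heq : ∀ s', |v s'| = ∑ s, |v s| * A s s' := fun s' =>
    (Finset.sum_eq_sum_iff_of_le fun s' _ => hle s').1 hsum s' (Finset.mem_univ s')
  have hpos : 0 < ∑ s, |v s| := by
    obtain ⟨i, hi⟩ := Function.ne_iff.1 hv0
    exact Finset.sum_pos' (fun s _ => abs_nonneg _) ⟨i, Finset.mem_univ i, abs_pos.2 hi⟩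
  have h0 : ∀ s, 0 ≤ |v s| / ∑ t, |v t| := fun s => by positivity
  have h1 : ∑ s, |v s| / ∑ t, |v t| = 1 := by rw [← Finset.sum_div, div_self hpos.ne']
  have h2 : ∀ s', ∑ s, |v s| / (∑ t, |v t|) * A s s' = |v s'| / ∑ t, |v t| := fun s' => by
    rw [heq s', Finset.sum_div]
    exact Finset.sum_congr rfl fun s _ => by ring
  exact ⟨_, pos_of_stationary hA h0 h1 h2, h1, h2⟩

/-- The Poisson equation of an irreducible chain is solvable: `g ↦ g - A g + ⟨q, g⟩` is injective,
hence onto. -/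
lemma exists_poisson {A : Matrix S S ℝ} (hA : A.IsIrreducible) (hrow : ∀ s, ∑ s', A s s' = 1)
    {q : S → ℝ} (hq1 : ∑ s, q s = 1) (hst : ∀ s', ∑ s, q s * A s s' = q s') (u : S → ℝ) :
    ∃ g : S → ℝ, ∀ s, u s - ∑ t, q t * u t = g s - ∑ s', A s s' * g s' := by
  have hqA : ∀ g : S → ℝ, ∑ s, q s * (g s - ∑ s', A s s' * g s') = 0 := fun g => by
    simp only [mul_sub, Finset.sum_sub_distrib, Finset.mul_sum, ← mul_assoc]
    rw [sub_eq_zero, eq_comm, Finset.sum_comm]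
    simp [← Finset.sum_mul, hst]
  let T : (S → ℝ) →ₗ[ℝ] (S → ℝ) :=
    { toFun := fun g s => g s - ∑ s', A s s' * g s' + ∑ t, q t * g t
      map_add' := fun g h => by
        funext s
        simp only [Pi.add_apply, mul_add, Finset.sum_add_distrib]
        ring
      map_smul' := fun c g => by
        funext s
        simp only [Pi.smul_apply, smul_eq_mul, RingHom.id_apply, mul_add, mul_sub, Finset.mul_sum,
          mul_left_comm c] }
  have hT : ∀ g s, T g s = g s - ∑ s', A s s' * g s' + ∑ t, q t * g t := fun g s => rfl
  have hqT : ∀ g, ∑ s, q s * T g s = ∑ t, q t * g t := fun g => by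
    simp only [hT, mul_add, Finset.sum_add_distrib, hqA, ← Finset.sum_mul, hq1]
    ring
  have hinj : Function.Injective T := by
    rw [← LinearMap.ker_eq_bot, LinearMap.ker_eq_bot']
    intro g hg
    have h0 : ∑ t, q t * g t = 0 := by rw [← hqT g, hg]; simp
    have h1 : ∀ s, ∑ s', A s s' * g s' = g s := fun s => by
      have := hT g s
      rw [hg, h0, Pi.zero_apply] at this
      linarith
    funext s
    have h2 : ∑ t, q t * g t = g s := by
      simp only [eq_of_harmonic hA hrow h1 _ s, ← Finset.sum_mul, hq1, one_mul]
    rw [← h2, h0, Pi.zero_apply]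
  obtain ⟨g, hg⟩ := LinearMap.injective_iff_surjective.1 hinj fun s => u s - ∑ t, q t * u t
  have h0 : ∑ t, q t * g t = 0 := by
    rw [← hqT g, hg]
    simp [mul_sub, Finset.sum_sub_distrib, ← Finset.sum_mul, hq1]
  refine ⟨g, fun s => ?_⟩
  have := hT g s
  rw [hg, h0, add_zero] at this
  exact this

variable [Fintype X]

/-! ### Words typical for a stationary pmf -/

open Classical in
/-- The transition matrix of the chain of states when letters are drawn by `w`. -/
noncomputable def transition (φ : S → X → S) (w : S × X → ℝ) : Matrix S S ℝ :=
  Matrix.of fun s s' => ∑ x, if φ s x = s' then w (s, x) else 0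

lemma sum_transition_mul (φ : S → X → S) (w : S × X → ℝ) (g : S → ℝ) (s : S) :
    ∑ s', transition φ w s s' * g s' = ∑ x, w (s, x) * g (φ s x) := by
  classical
  simp only [transition, Matrix.of_apply, Finset.sum_mul]
  rw [Finset.sum_comm]
  simp

lemma sum_transition (φ : S → X → S) {w : S × X → ℝ} (hw : ∀ s, ∑ x, w (s, x) = 1) (s : S) :
    ∑ s', transition φ w s s' = 1 := by
  simpa [hw] using sum_transition_mul φ w (fun _ => 1) s

lemma mem_irreducibleStationaryPmfs_iff {φ : S → X → S} {Q : S × X → ℝ} :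
    Q ∈ irreducibleStationaryPmfs φ ↔ Q ∈ stationaryPmfs φ ∧
      (transition φ fun p => condLetter Q p.1 p.2).IsIrreducible := Iff.rfl

lemma sum_stateMarginal {Q : S × X → ℝ} (hQ : Q ∈ stdSimplex ℝ (S × X)) :
    ∑ s, stateMarginal Q s = 1 := by
  rw [← hQ.2, Fintype.sum_prod_type]; rfl

lemma nonempty_of_mem_stdSimplex {Q : S × X → ℝ} (hQ : Q ∈ stdSimplex ℝ (S × X)) :
    Nonempty X := by
  by_contra h
  rw [not_nonempty_iff] at h
  simpa using hQ.2

lemma sum_stateMarginal_mul_transition {φ : S → X → S} {Q : S × X → ℝ}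
    (hQ : Q ∈ stationaryPmfs φ) (s' : S) :
    ∑ s, stateMarginal Q s * transition φ (fun p => condLetter Q p.1 p.2) s s' =
      stateMarginal Q s' := by
  rw [← hQ.2 s']
  refine Finset.sum_congr rfl fun s _ => ?_
  simp only [transition, Matrix.of_apply, Finset.mul_sum, mul_ite, mul_zero,
    stateMarginal_mul_condLetter hQ.1.1]

/-- The law of large numbers in mean square for sums along the path of an irreducible chain: up to
the increments of a solution of the Poisson equation, such a sum has increments with mean zero. -/
lemma sum_pathProd_mul_sq_sub_le {φ : S → X → S} {Q : S × X → ℝ}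
    (hQ : Q ∈ irreducibleStationaryPmfs φ) (f : S × X → ℝ) :
    ∃ C : ℝ, ∀ s n, ∑ x : Fin n → X, pathProd φ (fun p => condLetter Q p.1 p.2) s n x *
      (pathSum φ f s n x - n * ∑ p, Q p * f p) ^ 2 ≤ C * (n + 1) := by
  obtain ⟨hst, hirr⟩ := mem_irreducibleStationaryPmfs_iff.1 hQ
  have := nonempty_of_mem_stdSimplex hst.1
  set w : S × X → ℝ := fun p => condLetter Q p.1 p.2 with hw
  have hw0 : ∀ p, 0 ≤ w p := fun p => condLetter_nonneg hst.1.1 _ _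
  have hw1 : ∀ s, ∑ x, w (s, x) = 1 := sum_condLetter Q
  set m := ∑ p, Q p * f p with hm
  have hmean : ∑ t, stateMarginal Q t * ∑ x, w (t, x) * f (t, x) = m := by
    rw [hm, Fintype.sum_prod_type]
    refine Finset.sum_congr rfl fun s _ => ?_
    rw [Finset.mul_sum]
    refine Finset.sum_congr rfl fun x _ => ?_
    rw [← mul_assoc, stateMarginal_mul_condLetter hst.1.1]
  obtain ⟨g, hg⟩ := exists_poisson hirr (sum_transition φ hw1) (sum_stateMarginal hst.1)
    (sum_stateMarginal_mul_transition hst) fun s => ∑ x, w (s, x) * f (s, x)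
  simp only [hmean, sum_transition_mul] at hg
  -- Increments with mean zero in each state, by the Poisson equation for `g`.
  set h : S × X → ℝ := fun p => (f p + (-m) * 1) + (g (φ p.1 p.2) - g p.1) with hh
  have hh0 : ∀ s, ∑ x, w (s, x) * h (s, x) = 0 := fun s => by
    simp only [hh, mul_add, mul_sub, Finset.sum_add_distrib, Finset.sum_sub_distrib, mul_one,
      ← Finset.sum_mul, hw1]
    linarith [hg s]
  have hC : ∀ p, h p ^ 2 ≤ ∑ p, h p ^ 2 := fun p =>
    Finset.single_le_sum (f := fun p => h p ^ 2) (fun _ _ => sq_nonneg _) (Finset.mem_univ p)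
  have hD : ∀ a b, (g a - g b) ^ 2 ≤ ∑ p : S × S, (g p.1 - g p.2) ^ 2 := fun a b =>
    Finset.single_le_sum (f := fun p : S × S => (g p.1 - g p.2) ^ 2) (fun _ _ => sq_nonneg _)
      (Finset.mem_univ (a, b))
  set C := ∑ p, h p ^ 2
  set D := ∑ p : S × S, (g p.1 - g p.2) ^ 2
  have hC0 : 0 ≤ C := Finset.sum_nonneg fun _ _ => sq_nonneg _
  have hD0 : 0 ≤ D := Finset.sum_nonneg fun _ _ => sq_nonneg _
  refine ⟨2 * C + 2 * D, fun s n => ?_⟩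
  have hdec : ∀ x : Fin n → X, pathSum φ f s n x - n * m =
      pathSum φ h s n x - (g (pathEnd φ s n x) - g s) := fun x => by
    rw [hh, pathSum_add, pathSum_add, pathSum_const_mul, pathSum_one, pathSum_coboundary]
    ring
  calc _ ≤ ∑ x : Fin n → X, (2 * (pathProd φ w s n x * (0 + pathSum φ h s n x) ^ 2) +
          pathProd φ w s n x * (2 * D)) := Finset.sum_le_sum fun x _ => by
        rw [hdec]
        have h1 := hD (pathEnd φ s n x) s
        have h2 : (pathSum φ h s n x - (g (pathEnd φ s n x) - g s)) ^ 2 ≤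
            2 * (0 + pathSum φ h s n x) ^ 2 + 2 * D := by
          nlinarith [sq_nonneg (pathSum φ h s n x + (g (pathEnd φ s n x) - g s))]
        calc _ ≤ _ := mul_le_mul_of_nonneg_left h2 (pathProd_nonneg φ hw0 s n x)
          _ = _ := by ring
    _ ≤ 2 * (0 ^ 2 + n * C) + 1 * (2 * D) := by
        rw [Finset.sum_add_distrib, ← Finset.mul_sum, ← Finset.sum_mul, sum_pathProd φ hw1]
        linarith [sum_pathProd_mul_sq_le φ hw0 hw1 hh0 hC s n 0]
    _ ≤ (2 * C + 2 * D) * (n + 1) := by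
        have := mul_nonneg hD0 (Nat.cast_nonneg (α := ℝ) n)
        nlinarith

end GuessingLDP

namespace GuessingLDP

variable {S X : Type*} [Fintype S] [Fintype X]

lemma tendsto_mul_succ_div_sq (C ε : ℝ) :
    Tendsto (fun n : ℕ => C * ((n : ℝ) + 1) / ((n : ℝ) * ε) ^ 2) atTop (𝓝 0) := by
  have h1 : Tendsto (fun n : ℕ => (C / ε ^ 2) * ((1 : ℝ) / n + (1 / n) * (1 / n))) atTop
      (𝓝 ((C / ε ^ 2) * (0 + 0 * 0))) :=
    ((tendsto_const_div_atTop_nhds_zero_nat 1).add ((tendsto_const_div_atTop_nhds_zero_nat 1).mul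
      (tendsto_const_div_atTop_nhds_zero_nat 1))).const_mul _
  simp only [mul_zero, add_zero] at h1
  refine h1.congr' ?_
  filter_upwards [eventually_ne_atTop 0] with n hn
  have hn0 : (n : ℝ) ≠ 0 := by exact_mod_cast hn
  rcases eq_or_ne ε 0 with h | h
  · simp [h]
  · field_simp

namespace UnifilarSource

variable (U : UnifilarSource S X)

/-- Words typical for an irreducible stationary `Q`: the law of large numbers, for the source that
draws letters by `η`, applies to both `ln η` and `ln π`. -/
lemma exists_typical_of_irreducible {Q : S × X → ℝ} (hQ : Q ∈ irreducibleStationaryPmfs U.φ)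
    (hac : U.AbsCont Q) (s : S) {ε : ℝ} (hε : 0 < ε) :
    ∀ᶠ n : ℕ in atTop, ∃ A : Finset (Fin n → X),
      Real.exp (n * (condEntropy Q - ε)) ≤ A.card ∧
      ∀ x ∈ A, 0 < U.prob s n x ∧ |Real.log (U.prob s n x) + n * U.meanInfo Q| < n * ε := by
  classical
  obtain ⟨hst, hirr⟩ := mem_irreducibleStationaryPmfs_iff.1 hQ
  have := U.nonempty_letter s
  have hQ0 := hst.1.1
  set w : S × X → ℝ := fun p => condLetter Q p.1 p.2 with hw
  have hw0 : ∀ p, 0 ≤ w p := fun p => condLetter_nonneg hQ0 _ _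
  have hw1 : ∀ s, ∑ x, w (s, x) = 1 := sum_condLetter Q
  have hq : ∀ s, 0 < stateMarginal Q s :=
    pos_of_stationary hirr (fun s => Finset.sum_nonneg fun _ _ => hQ0 _)
      (sum_stateMarginal hst.1) (sum_stateMarginal_mul_transition hst)
  have hwU : ∀ p, w p ≠ 0 → 0 < U.weight p := fun p hp => by
    refine (U.weight_nonneg p).lt_of_ne fun h => hp ?_
    have h0 : Q p = 0 := hac p.1 p.2 h.symm
    simp [hw, condLetter, h0, (hq p.1).ne']
  obtain ⟨C₁, hC₁⟩ := sum_pathProd_mul_sq_sub_le hQ fun p => Real.log (w p)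
  obtain ⟨C₂, hC₂⟩ := sum_pathProd_mul_sq_sub_le hQ fun p => Real.log (U.weight p)
  have hH : ∑ p, Q p * Real.log (w p) = -condEntropy Q := by
    rw [condEntropy_eq_neg_sum hQ0, neg_neg]
  have hL : ∑ p, Q p * Real.log (U.weight p) = -U.meanInfo Q := by rw [meanInfo_eq, neg_neg]
  rw [hH] at hC₁
  rw [hL] at hC₂
  have hε2 : 0 < ε / 2 := by positivity
  have hexp : Tendsto (fun n : ℕ => Real.exp (-((n : ℝ) * (ε / 2)))) atTop (𝓝 0) :=
    Real.tendsto_exp_neg_atTop_nhds_zero.comp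
      (tendsto_natCast_atTop_atTop.atTop_mul_const hε2)
  filter_upwards [(tendsto_mul_succ_div_sq (C₁ + C₂) (ε / 2)).eventually
      (gt_mem_nhds (by norm_num : (0 : ℝ) < 1 / 2)), hexp.eventually
      (gt_mem_nhds (by norm_num : (0 : ℝ) < 1 / 2)), eventually_gt_atTop 0] with n hn hn' hn0
  have hn1 : (0 : ℝ) < n := by exact_mod_cast hn0
  set d₁ : (Fin n → X) → ℝ := fun x =>
    pathSum U.φ (fun p => Real.log (w p)) s n x - n * -condEntropy Q with hd₁
  set d₂ : (Fin n → X) → ℝ := fun x =>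
    pathSum U.φ (fun p => Real.log (U.weight p)) s n x - n * -U.meanInfo Q with hd₂
  set P : (Fin n → X) → ℝ := pathProd U.φ w s n with hP
  have hP0 : ∀ x, 0 ≤ P x := pathProd_nonneg U.φ hw0 s n
  set r : ℝ := n * (ε / 2) with hr
  have hr0 : 0 < r := by positivity
  set A := Finset.univ.filter fun x => P x ≠ 0 ∧ |d₁ x| < r ∧ |d₂ x| < r with hA
  have hpos : ∀ x ∈ A, ∀ p, pathCount U.φ s n x p ≠ 0 → w p ≠ 0 := fun x hx p hp =>
    ne_zero_of_pathProd_ne_zero U.φ (Finset.mem_filter.1 hx).2.1 hp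
  have hPA : ∀ x ∈ A, P x ≤ Real.exp (-(n * (condEntropy Q - ε / 2))) := fun x hx => by
    have h1 := (abs_lt.1 (Finset.mem_filter.1 hx).2.2.1).2
    rw [hP, pathProd_eq_exp U.φ s n x fun p hp => (hw0 p).lt_of_ne (hpos x hx p hp).symm]
    refine Real.exp_le_exp.2 ?_
    simp only [hd₁, hr] at h1
    linarith
  have hhalf : 1 / 2 ≤ ∑ x ∈ A, P x := by
    -- Chebyshev's inequality for both deviations at once.
    have hpt : ∀ x, P x ≤ (if x ∈ A then P x else 0) +
        (P x * d₁ x ^ 2 + P x * d₂ x ^ 2) / r ^ 2 := fun x => by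
      have hnn : 0 ≤ (P x * d₁ x ^ 2 + P x * d₂ x ^ 2) / r ^ 2 := by
        have := hP0 x
        positivity
      by_cases hx : x ∈ A
      · simpa [hx] using hnn
      by_cases h0 : P x = 0
      · simp [h0]
      have hbig : r ^ 2 ≤ d₁ x ^ 2 + d₂ x ^ 2 := by
        by_contra! hlt
        refine hx (Finset.mem_filter.2 ⟨Finset.mem_univ x, h0, ?_, ?_⟩) <;>
        · rw [← abs_of_pos hr0, ← sq_lt_sq]
          nlinarith [sq_nonneg (d₁ x), sq_nonneg (d₂ x)]
      rw [if_neg hx, zero_add, le_div_iff₀ (by positivity), ← mul_add]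
      exact mul_le_mul_of_nonneg_left hbig (hP0 x)
    have h1 := Finset.sum_le_sum fun x (_ : x ∈ Finset.univ) => hpt x
    rw [sum_pathProd U.φ hw1, Finset.sum_add_distrib, Finset.sum_ite_mem, Finset.univ_inter,
      ← Finset.sum_div, Finset.sum_add_distrib] at h1
    have h2 : (∑ x, P x * d₁ x ^ 2 + ∑ x, P x * d₂ x ^ 2) / r ^ 2 ≤
        (C₁ + C₂) * ((n : ℝ) + 1) / r ^ 2 :=
      div_le_div_of_nonneg_right (by linarith [hC₁ s n, hC₂ s n]) (by positivity)
    linarith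
  refine ⟨A, ?_, fun x hx => ?_⟩
  · have h1 : 1 / 2 ≤ (A.card : ℝ) * Real.exp (-(n * (condEntropy Q - ε / 2))) := by
      refine hhalf.trans ((Finset.sum_le_sum hPA).trans_eq ?_)
      rw [Finset.sum_const, nsmul_eq_mul]
    have h2 : Real.exp (n * (condEntropy Q - ε)) =
        Real.exp (-(n * (ε / 2))) * Real.exp (n * (condEntropy Q - ε / 2)) := by
      rw [← Real.exp_add]; ring_nf
    rw [Real.exp_neg, ← div_eq_mul_inv, le_div_iff₀ (Real.exp_pos _)] at h1
    rw [h2]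
    exact (mul_le_mul_of_nonneg_right hn'.le (Real.exp_pos _).le).trans h1
  · have h1 : U.prob s n x = _ := (U.prob_eq_pathProd s n x).trans
      (pathProd_eq_exp U.φ s n x fun p hp => hwU p (hpos x hx p hp))
    refine ⟨h1 ▸ Real.exp_pos _, ?_⟩
    have h2 := (Finset.mem_filter.1 hx).2.2.2
    rw [h1, Real.log_exp]
    simp only [hd₂, hr] at h2
    have h3 : (n : ℝ) * (ε / 2) < n * ε := by nlinarith
    rw [show ∀ y : ℝ, y + n * U.meanInfo Q = y - n * -U.meanInfo Q from fun y => by ring]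
    exact h2.trans h3

/-- The irreducible source has a stationary pmf, which charges exactly the pairs of positive
probability. -/
lemma exists_stationary_pos (hU : U.Irreducible) (s₀ : S) :
    ∃ Q ∈ stationaryPmfs U.φ, U.AbsCont Q ∧ ∀ p, 0 < U.weight p → 0 < Q p := by
  classical
  have : Nonempty S := ⟨s₀⟩
  have hA : (transition U.φ U.weight) = U.stateMatrix := by
    ext s s'
    simp [transition, stateMatrix, pi_eq]
  obtain ⟨q, hq, hq1, hst⟩ := exists_stationary (A := transition U.φ U.weight)
    (hA ▸ hU) (sum_transition U.φ U.sum_weight)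
  have hmarg : stateMarginal (fun p => q p.1 * U.weight p) = q := by
    funext s
    simp [stateMarginal, ← Finset.mul_sum, U.sum_weight]
  refine ⟨fun p => q p.1 * U.weight p,
    ⟨⟨fun p => mul_nonneg (hq _).le (U.weight_nonneg p), ?_⟩, ?_⟩,
    fun s x hx => ?_, fun p hp => mul_pos (hq _) hp⟩
  · simpa [Fintype.sum_prod_type, ← Finset.mul_sum, U.sum_weight] using hq1
  · intro s'
    rw [hmarg, ← hst s']
    simp [transition, Finset.mul_sum, mul_ite]
  · simp [weight, hx]

lemma stationarityDefect_convex (φ : S → X → S) (Q R : S × X → ℝ) (a b : ℝ) (s' : S) :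
    stationarityDefect φ (a • Q + b • R) s' =
      a * stationarityDefect φ Q s' + b * stationarityDefect φ R s' := by
  classical
  have h : ∀ s x, (if φ s x = s' then (a • Q + b • R) (s, x) else 0) =
      a * (if φ s x = s' then Q (s, x) else 0) + b * (if φ s x = s' then R (s, x) else 0) :=
    fun s x => by split_ifs <;> simp
  simp only [stationarityDefect, stateMarginal, h, Finset.sum_add_distrib, ← Finset.mul_sum]
  simp only [Pi.add_apply, Pi.smul_apply, smul_eq_mul, Finset.sum_add_distrib, ← Finset.mul_sum]
  ring

/-- Mixing with the stationary pmf of the source makes a stationary pmf irreducible, at an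
arbitrarily small change of its entropy and mean information. -/
lemma exists_irreducible_near (hU : U.Irreducible) (s₀ : S) {Q : S × X → ℝ}
    (hQ : Q ∈ stationaryPmfs U.φ) (hac : U.AbsCont Q) {ε : ℝ} (hε : 0 < ε) :
    ∃ R ∈ irreducibleStationaryPmfs U.φ, U.AbsCont R ∧
      |condEntropy R - condEntropy Q| < ε ∧ |U.meanInfo R - U.meanInfo Q| < ε := by
  classical
  obtain ⟨P, hP, hPac, hPpos⟩ := U.exists_stationary_pos hU s₀
  set R : ℝ → S × X → ℝ := fun t => (1 - t) • Q + t • P with hR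
  have hRc : Continuous R := by fun_prop
  have hR0 : R 0 = Q := by simp [hR]
  have hRst : ∀ t ∈ Set.Icc (0 : ℝ) 1, R t ∈ stationaryPmfs U.φ := fun t ht => by
    rw [mem_stationaryPmfs_iff] at hQ hP ⊢
    refine ⟨convex_stdSimplex ℝ _ hQ.1 hP.1 (sub_nonneg.2 ht.2) ht.1 (by ring), fun s' => ?_⟩
    rw [hR, stationarityDefect_convex, hQ.2, hP.2]
    ring
  have hRac : ∀ t, U.AbsCont (R t) := fun t s x hx => by
    simp [hR, hac s x hx, hPac s x hx]
  have hRirr : ∀ t ∈ Set.Ioc (0 : ℝ) 1, R t ∈ irreducibleStationaryPmfs U.φ := fun t ht => by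
    have hst := hRst t ⟨ht.1.le, ht.2⟩
    refine mem_irreducibleStationaryPmfs_iff.2 ⟨hst, isIrreducible_mono hU (fun s s' =>
      Finset.sum_nonneg fun x _ => ?_) fun s s' hss => ?_⟩
    · split_ifs
      · exact condLetter_nonneg hst.1.1 s x
      · exact le_rfl
    · simp only [stateMatrix, Matrix.of_apply, pi_eq] at hss
      obtain ⟨x, -, hx⟩ := Finset.exists_ne_zero_of_sum_ne_zero hss.ne'
      have hφ : U.φ s x = s' := by
        by_contra h
        simp [h] at hx
      rw [if_pos hφ] at hx
      have hwx : 0 < U.weight (s, x) := (U.weight_nonneg _).lt_of_ne hx.symm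
      have hRx : 0 < R t (s, x) := by
        have h1 : 0 ≤ (1 - t) * Q (s, x) := mul_nonneg (sub_nonneg.2 ht.2) (hQ.1.1 _)
        have h2 : 0 < t * P (s, x) := mul_pos ht.1 (hPpos _ hwx)
        simpa [hR] using add_pos_of_nonneg_of_pos h1 h2
      refine Finset.sum_pos' (fun y _ => ?_) ⟨x, Finset.mem_univ x, ?_⟩
      · split_ifs
        · exact condLetter_nonneg hst.1.1 s y
        · exact le_rfl
      · rw [if_pos hφ]
        refine (condLetter_nonneg hst.1.1 s x).lt_of_ne fun h => hRx.ne' ?_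
        rw [← stateMarginal_mul_condLetter hst.1.1]
        simp [← h]
  have hmaps : Set.MapsTo R (Set.Ioc (0 : ℝ) 1) (stdSimplex ℝ (S × X)) := fun t ht =>
    (hRst t ⟨ht.1.le, ht.2⟩).1
  have hlimR : Tendsto R (𝓝[Set.Ioc (0 : ℝ) 1] 0) (𝓝[stdSimplex ℝ (S × X)] Q) :=
    tendsto_nhdsWithin_iff.2 ⟨hR0 ▸ hRc.continuousWithinAt.tendsto,
      eventually_mem_nhdsWithin.mono hmaps⟩
  have hH := (continuousOn_condEntropy Q hQ.1).tendsto.comp hlimR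
  have hL := (U.continuous_meanInfo.continuousWithinAt (x := Q)).tendsto.comp hlimR
  have : (𝓝[Set.Ioc (0 : ℝ) 1] 0).NeBot := by
    rw [nhdsWithin_Ioc_eq_nhdsGT one_pos]; infer_instance
  obtain ⟨t, ht, h1, h2⟩ := (eventually_mem_nhdsWithin.and
    ((Metric.tendsto_nhds.1 hH ε hε).and (Metric.tendsto_nhds.1 hL ε hε))).exists
  exact ⟨R t, hRirr t ht, hRac t, h1, h2⟩

/-- For every stationary `Q` that charges only pairs of positive probability there are about
`exp (n H(η ∣ q))` words each of which has probability about
`exp (-n (H(η ∣ q) + D(η ‖ π ∣ q)))`. -/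
lemma exists_typical (hU : U.Irreducible) {Q : S × X → ℝ} (hQ : Q ∈ stationaryPmfs U.φ)
    (hac : U.AbsCont Q) (s : S) {ε : ℝ} (hε : 0 < ε) :
    ∀ᶠ n : ℕ in atTop, ∃ A : Finset (Fin n → X),
      Real.exp (n * (condEntropy Q - ε)) ≤ A.card ∧
      ∀ x ∈ A, 0 < U.prob s n x ∧ |Real.log (U.prob s n x) + n * U.meanInfo Q| < n * ε := by
  obtain ⟨R, hR, hRac, h1, h2⟩ := U.exists_irreducible_near hU s hQ hac (half_pos hε)
  rw [abs_lt] at h1 h2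
  filter_upwards [U.exists_typical_of_irreducible hR hRac s (half_pos hε), eventually_gt_atTop 0]
    with n hn hn0
  have hn1 : (0 : ℝ) < n := by exact_mod_cast hn0
  obtain ⟨A, hA, hx⟩ := hn
  refine ⟨A, le_trans (Real.exp_le_exp.2 
    (mul_le_mul_of_nonneg_left (by linarith) hn1.le)) hA, fun x hxA => ⟨(hx x hxA).1, ?_⟩⟩
  have h3 := abs_lt.1 (hx x hxA).2
  have h4 : n * (U.meanInfo R - U.meanInfo Q) < n * (ε / 2) := mul_lt_mul_of_pos_left h2.2 hn1
  have h5 : n * (-(ε / 2)) < n * (U.meanInfo R - U.meanInfo Q) := mul_lt_mul_of_pos_left h2.1 hn1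
  rw [abs_lt]
  constructor <;> linarith

end UnifilarSource

end GuessingLDP

namespace GuessingLDP

/-! ### Moments of guessing functions -/

/-- Arikan's upper bound: `G(a)` is at most the number of `b` with `P b ≥ P a`, hence at most
`∑ b, (P b / P a) ^ (1 / (1 + ρ))`. -/
lemma guessingMoment_le {α : Type*} [Fintype α] {P : α → ℝ} (hP : ∀ a, 0 ≤ P a) {G : α → ℕ}
    (hG : IsOptimalGuessing P G) {ρ : ℝ} (hρ : 0 < ρ) :
    guessingMoment P G ρ ≤ (∑ a, P a ^ (1 / (1 + ρ))) ^ (1 + ρ) := by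
  classical
  set θ : ℝ := 1 / (1 + ρ) with hθ
  have hθ0 : 0 < θ := by positivity
  set Z := ∑ a, P a ^ θ with hZ
  have hZ0 : 0 ≤ Z := Finset.sum_nonneg fun a _ => Real.rpow_nonneg (hP a) _
  have hbound : ∀ a, P a ^ θ * G a ≤ Z := fun a => by
    have hcard : G a ≤ (Finset.univ.filter fun b => G b ≤ G a).card := by
      have hsub : Finset.Icc 1 (G a) ⊆ (Finset.univ.filter fun b => G b ≤ G a).image G := by
        intro k hk
        rw [Finset.mem_Icc] at hk
        obtain ⟨b, -, hb⟩ := hG.1.surjOn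
          (show k ∈ Set.Icc 1 (Fintype.card α) from
            ⟨hk.1, hk.2.trans (hG.1.mapsTo (Set.mem_univ a)).2⟩)
        exact Finset.mem_image.2 ⟨b, by simpa [hb] using hk.2, hb⟩
      simpa using (Finset.card_le_card hsub).trans Finset.card_image_le
    calc P a ^ θ * G a ≤ P a ^ θ * (Finset.univ.filter fun b => G b ≤ G a).card :=
          mul_le_mul_of_nonneg_left (by exact_mod_cast hcard) (Real.rpow_nonneg (hP a) _)
      _ = ∑ _b ∈ Finset.univ.filter fun b => G b ≤ G a, P a ^ θ := by
          rw [Finset.sum_const, nsmul_eq_mul, mul_comm]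
      _ ≤ ∑ b ∈ Finset.univ.filter fun b => G b ≤ G a, P b ^ θ :=
          Finset.sum_le_sum fun b hb => Real.rpow_le_rpow (hP a) (by
            by_contra! hlt
            exact (hG.2 a b hlt).not_ge (Finset.mem_filter.1 hb).2) hθ0.le
      _ ≤ Z := Finset.sum_le_sum_of_subset_of_nonneg (Finset.subset_univ _) fun b _ _ =>
          Real.rpow_nonneg (hP b) _
  have hsplit : ∀ a, P a = P a ^ θ * (P a ^ θ) ^ ρ := fun a => by
    rw [← Real.rpow_mul (hP a), ← Real.rpow_add_of_nonneg (hP a) hθ0.le (by positivity),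
      show θ + θ * ρ = 1 by rw [hθ]; field_simp, Real.rpow_one]
  calc guessingMoment P G ρ ≤ ∑ a, P a ^ θ * Z ^ ρ := Finset.sum_le_sum fun a _ => by
        nth_rewrite 1 [hsplit a]
        rw [mul_assoc, ← Real.mul_rpow (Real.rpow_nonneg (hP a) _) (Nat.cast_nonneg _)]
        exact mul_le_mul_of_nonneg_left (Real.rpow_le_rpow
          (mul_nonneg (Real.rpow_nonneg (hP a) _) (Nat.cast_nonneg _)) (hbound a) hρ.le)
          (Real.rpow_nonneg (hP a) _)
    _ = Z ^ (1 + ρ) := by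
        rw [← Finset.sum_mul, Real.rpow_add_of_nonneg hZ0 zero_le_one hρ.le, Real.rpow_one]

/-- Whatever the order of the guesses, at least half of the elements of `A` need at least
`|A| / 2` guesses. -/
lemma le_guessingMoment {α : Type*} [Fintype α] {P : α → ℝ} (hP : ∀ a, 0 ≤ P a) {G : α → ℕ}
    (hG : Set.BijOn G Set.univ (Set.Icc 1 (Fintype.card α))) {ρ : ℝ} (hρ : 0 < ρ) (A : Finset α)
    {c : ℝ} (hc : 0 ≤ c) (hA : ∀ a ∈ A, c ≤ P a) :
    c * ((A.card : ℝ) / 2) ^ (1 + ρ) ≤ guessingMoment P G ρ := by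
  classical
  set m := A.card / 2 with hm
  have hcard : (A.filter fun a => G a ≤ m).card ≤ m := by
    have hsub : (A.filter fun a => G a ≤ m).image G ⊆ Finset.Icc 1 m := by
      intro k hk
      obtain ⟨a, ha, rfl⟩ := Finset.mem_image.1 hk
      exact Finset.mem_Icc.2 ⟨(hG.mapsTo (Set.mem_univ a)).1, (Finset.mem_filter.1 ha).2⟩
    have h1 := Finset.card_le_card hsub
    rwa [Finset.card_image_of_injOn (hG.injOn.mono (Set.subset_univ _)), Nat.card_Icc,
      Nat.add_sub_cancel] at h1
  have hsum := Finset.card_filter_add_card_filter_not (s := A) fun a => G a ≤ m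
  have hbig : (A.card : ℝ) / 2 ≤ (A.filter fun a => ¬ G a ≤ m).card := by
    rw [div_le_iff₀ two_pos]
    exact_mod_cast (by omega : A.card ≤ (A.filter fun a => ¬ G a ≤ m).card * 2)
  have hhalf : (A.card : ℝ) / 2 ≤ m + 1 := by
    rw [div_le_iff₀ two_pos]
    exact_mod_cast (by omega : A.card ≤ (m + 1) * 2)
  have h0 : (0 : ℝ) ≤ (A.card : ℝ) / 2 := by positivity
  calc c * ((A.card : ℝ) / 2) ^ (1 + ρ)
      = (A.card : ℝ) / 2 * (c * ((A.card : ℝ) / 2) ^ ρ) := by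
        rw [Real.rpow_add_of_nonneg h0 zero_le_one hρ.le, Real.rpow_one]; ring
    _ ≤ (A.filter fun a => ¬ G a ≤ m).card * (c * ((A.card : ℝ) / 2) ^ ρ) :=
        mul_le_mul_of_nonneg_right hbig (by positivity)
    _ = ∑ _a ∈ A.filter fun a => ¬ G a ≤ m, c * ((A.card : ℝ) / 2) ^ ρ := by
        rw [Finset.sum_const, nsmul_eq_mul]
    _ ≤ ∑ a ∈ A.filter fun a => ¬ G a ≤ m, P a * (G a : ℝ) ^ ρ := Finset.sum_le_sum fun a ha => by
        obtain ⟨haA, ham⟩ := Finset.mem_filter.1 ha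
        have h1 : (m : ℝ) + 1 ≤ G a := by exact_mod_cast not_le.1 ham
        exact mul_le_mul (hA a haA) (Real.rpow_le_rpow h0 (hhalf.trans h1) hρ.le)
          (Real.rpow_nonneg h0 _) (hP a)
    _ ≤ guessingMoment P G ρ :=
        Finset.sum_le_sum_of_subset_of_nonneg (Finset.subset_univ _) fun a _ _ =>
          mul_nonneg (hP a) (Real.rpow_nonneg (Nat.cast_nonneg _) _)

/-! ### The information spectrum -/

variable {S X : Type*} [Fintype S] [Fintype X]

open Classical in
lemma infoSpectrum_apply {n : ℕ} {P : (Fin n → X) → ℝ} (hP : ∀ x, 0 ≤ P x) (K : Set ℝ) :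
    infoSpectrum n P K = ENNReal.ofReal
      (∑ x ∈ Finset.univ.filter fun x => -(n : ℝ)⁻¹ * Real.log (P x) ∈ K, P x) := by
  rw [ENNReal.ofReal_sum_of_nonneg fun x _ => hP x, Finset.sum_filter, infoSpectrum,
    Measure.finsetSum_apply]
  refine Finset.sum_congr rfl fun x _ => ?_
  rw [Measure.smul_apply, Measure.dirac_apply, smul_eq_mul, Set.indicator_apply]
  split_ifs <;> simp

/-- The exponential rate of a polynomial times an exponential. -/
lemma tendsto_log_succ_div (d a : ℝ) :
    Tendsto (fun n : ℕ => (d * Real.log (n + 1) + n * a) / n) atTop (𝓝 a) := by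
  have h1 : Tendsto (fun n : ℕ => Real.log ((n : ℝ) + 1) / ((n : ℝ) + 1)) atTop (𝓝 0) :=
    (Real.isLittleO_log_id_atTop.tendsto_div_nhds_zero).comp
      (tendsto_atTop_add_const_right _ 1 tendsto_natCast_atTop_atTop)
  have h2 : Tendsto (fun n : ℕ => (1 : ℝ) + 1 / n) atTop (𝓝 (1 + 0)) :=
    tendsto_const_nhds.add (tendsto_const_div_atTop_nhds_zero_nat 1)
  have h3 := ((h1.mul h2).const_mul d).add_const a
  simp only [zero_mul, mul_zero, zero_add] at h3
  refine h3.congr' ?_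
  filter_upwards [eventually_ne_atTop 0] with n hn
  have : (n : ℝ) ≠ 0 := by exact_mod_cast hn
  have : (n : ℝ) + 1 ≠ 0 := by positivity
  field_simp

namespace UnifilarSource

variable (U : UnifilarSource S X)

lemma absCont_empirical {s : S} {n : ℕ} {x : Fin n → X} (h : U.prob s n x ≠ 0) :
    U.AbsCont (empirical U.φ s n x) := fun t a hta => by
  rw [prob_eq_pathProd] at h
  have : pathCount U.φ s n x (t, a) = 0 := by
    by_contra h0
    exact ne_zero_of_pathProd_ne_zero U.φ h h0 hta
  simp [empirical, this]

/-- The probability of a word is a function of its empirical distribution. -/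
lemma prob_eq_exp {s : S} {n : ℕ} (hn : n ≠ 0) {x : Fin n → X} (h : U.prob s n x ≠ 0) :
    U.prob s n x = Real.exp (-(n * U.meanInfo (empirical U.φ s n x))) := by
  rw [prob_eq_pathProd] at h ⊢
  rw [pathProd_eq_exp U.φ s n x fun p hp =>
      (U.weight_nonneg p).lt_of_ne (ne_zero_of_pathProd_ne_zero U.φ h hp).symm,
    pathSum_eq_mul_empirical U.φ _ s hn, meanInfo_eq]
  simp

lemma rate_le {Q : S × X → ℝ} (hQ : Q ∈ stationaryPmfs U.φ) (hac : U.AbsCont Q) :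
    U.rate (U.meanInfo Q) ≤ ((U.meanInfo Q - condEntropy Q : ℝ) : EReal) := by
  rw [← U.condRelEntropy_eq hQ.1.1 hac]
  exact iInf₂_le Q ⟨hQ, hac, rfl⟩

lemma rate_nonneg (t : ℝ) : 0 ≤ U.rate t :=
  le_iInf₂ fun _ hQ => U.condRelEntropy_nonneg hQ.1.1.1

lemma isCompact_stationary_absCont : IsCompact (stationaryPmfs U.φ ∩ {Q | U.AbsCont Q}) :=
  (isCompact_stationaryPmfs U.φ).inter_right U.isClosed_absCont

lemma continuousOn_meanInfo_sub :
    ContinuousOn (fun Q => U.meanInfo Q - condEntropy Q) (stdSimplex ℝ (S × X)) :=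
  U.continuous_meanInfo.continuousOn.sub continuousOn_condEntropy

/-- The infimum that defines the rate function is attained where it is finite, so that the level
sets are images of compact sets of pmfs. -/
lemma setOf_rate_le (a : ℝ) : {t | U.rate t ≤ (a : EReal)} = U.meanInfo ''
    ((stationaryPmfs U.φ ∩ {Q | U.AbsCont Q}) ∩
      (stdSimplex ℝ (S × X) ∩ (fun Q => U.meanInfo Q - condEntropy Q) ⁻¹' Set.Iic a)) := by
  ext t
  constructor
  · intro ht
    have hθ : IsCompact (U.theta t) := by
      have : U.theta t = (stationaryPmfs U.φ ∩ {Q | U.AbsCont Q}) ∩ U.meanInfo ⁻¹' {t} := by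
        ext Q; simp only [theta, AbsCont]; constructor
        · exact fun h => ⟨⟨h.1, h.2.1⟩, h.2.2⟩
        · exact fun h => ⟨h.1.1, h.1.2, h.2⟩
      rw [this]
      exact U.isCompact_stationary_absCont.inter_right
        (isClosed_singleton.preimage U.continuous_meanInfo)
    have hne : (U.theta t).Nonempty := by
      by_contra h0
      rw [Set.not_nonempty_iff_eq_empty] at h0
      have h1 : U.rate t = ⊤ := by simp [rate, h0]
      have h2 : U.rate t ≤ (a : EReal) := ht
      rw [h1, top_le_iff] at h2
      exact EReal.coe_ne_top a h2
    obtain ⟨Q, hQ, hmin⟩ := hθ.exists_isMinOn hne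
      (U.continuousOn_meanInfo_sub.mono fun Q hQ => hQ.1.1)
    refine ⟨Q, ⟨⟨hQ.1, hQ.2.1⟩, hQ.1.1, ?_⟩, hQ.2.2⟩
    have h1 : ((U.meanInfo Q - condEntropy Q : ℝ) : EReal) ≤ U.rate t :=
      le_iInf₂ fun Q' hQ' => by
        rw [U.condRelEntropy_eq hQ'.1.1.1 hQ'.2.1]
        exact EReal.coe_le_coe_iff.2 (hmin hQ')
    exact EReal.coe_le_coe_iff.1 (h1.trans ht)
  · rintro ⟨Q, ⟨⟨hQ, hac⟩, -, hle⟩, rfl⟩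
    exact (U.rate_le hQ hac).trans (EReal.coe_le_coe_iff.2 hle)

lemma isCompact_setOf_rate_le (a : ℝ) : IsCompact {t | U.rate t ≤ (a : EReal)} := by
  rw [setOf_rate_le]
  exact (U.isCompact_stationary_absCont.inter_right
    (U.continuousOn_meanInfo_sub.preimage_isClosed_of_isClosed (isClosed_stdSimplex ℝ _)
      isClosed_Iic)).image U.continuous_meanInfo

lemma lowerSemicontinuous_rate : LowerSemicontinuous U.rate := by
  rw [lowerSemicontinuous_iff_isClosed_preimage]
  intro y
  induction y with
  | bot =>
    convert isClosed_empty
    ext t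
    simpa using ((EReal.bot_lt_zero).trans_le (U.rate_nonneg t)).ne'
  | coe a => exact (U.isCompact_setOf_rate_le a).isClosed
  | top => simp

/-- The large deviation upper bound. -/
lemma limsup_infoSpectrum_le (s₀ : S) {K : Set ℝ} (hK : IsClosed K) :
    limsup (fun n : ℕ => ENNReal.log (infoSpectrum n (U.prob s₀ n) K) / (n : EReal)) atTop ≤
      - ⨅ t ∈ K, U.rate t := by
  classical
  have := U.nonempty_letter s₀
  by_contra! hlt
  obtain ⟨b, hb1, hb2⟩ := EReal.lt_iff_exists_real_btwn.1 hlt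
  refine hb2.not_ge ?_
  have hB : IsClosed ({Q | U.AbsCont Q} ∩ U.meanInfo ⁻¹' K) :=
    U.isClosed_absCont.inter (hK.preimage U.continuous_meanInfo)
  have hev := eventually_empirical_lt U.φ hB
    (continuousOn_condEntropy.sub U.continuous_meanInfo.continuousOn) (a := b) fun Q hQ hQB => by
      have h1 := (iInf₂_le (f := fun t (_ : t ∈ K) => U.rate t) _ hQB.2).trans (U.rate_le hQ hQB.1)
      have h2 := (EReal.neg_le_neg_iff.2 h1).trans_lt hb1
      rw [← EReal.coe_neg, EReal.coe_lt_coe_iff] at h2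
      simp only [Pi.sub_apply]
      linarith
  set d : ℝ := (Fintype.card (S × X) : ℝ) with hd
  have hlim : Tendsto (fun n : ℕ => (((d * Real.log (n + 1) + n * b) / n : ℝ) : EReal)) atTop
      (𝓝 (b : EReal)) :=
    (continuous_coe_real_ereal.tendsto b).comp (tendsto_log_succ_div d b)
  rw [← hlim.limsup_eq]
  refine limsup_le_limsup ?_
  filter_upwards [hev, eventually_gt_atTop 0] with n hn hn0
  have hsum : ∑ x ∈ Finset.univ.filter fun x => -(n : ℝ)⁻¹ * Real.log (U.prob s₀ n x) ∈ K,
      U.prob s₀ n x ≤ ((n : ℝ) + 1) ^ Fintype.card (S × X) * Real.exp (n * b) := by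
    refine le_trans ?_ (sum_exp_empirical_le U.φ s₀ hn0.ne' ({Q | U.AbsCont Q} ∩ U.meanInfo ⁻¹' K)
      U.meanInfo fun x hx => (hn s₀ x hx).le)
    rw [Finset.sum_filter, Finset.sum_filter]
    refine Finset.sum_le_sum fun x _ => ?_
    by_cases h0 : U.prob s₀ n x = 0
    · rw [h0, ite_self]
      split_ifs <;> positivity
    · have h1 := U.prob_eq_exp hn0.ne' h0
      by_cases hx : -(n : ℝ)⁻¹ * Real.log (U.prob s₀ n x) ∈ K
      · have h2 : empirical U.φ s₀ n x ∈ {Q | U.AbsCont Q} ∩ U.meanInfo ⁻¹' K := by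
          refine ⟨U.absCont_empirical h0, ?_⟩
          rw [h1, Real.log_exp] at hx
          have : (n : ℝ) ≠ 0 := by positivity
          simpa [this] using hx
        rw [if_pos hx, if_pos h2, h1]
      · rw [if_neg hx]
        split_ifs <;> positivity
  have hn1 : (0 : ℝ) < n := by exact_mod_cast hn0
  have hpos : 0 < ((n : ℝ) + 1) ^ Fintype.card (S × X) * Real.exp (n * b) := by positivity
  have hlog : ENNReal.log (infoSpectrum n (U.prob s₀ n) K) ≤
      ((d * Real.log (n + 1) + n * b : ℝ) : EReal) := by
    rw [infoSpectrum_apply (U.prob_nonneg s₀ n)]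
    refine (ENNReal.log_le_log (ENNReal.ofReal_le_ofReal hsum)).trans_eq ?_
    rw [ENNReal.log_ofReal_of_pos hpos, Real.log_mul (by positivity) (Real.exp_pos _).ne',
      Real.log_pow, Real.log_exp]
  rw [EReal.coe_div]
  exact EReal.div_le_div_right_of_nonneg (by positivity) hlog

/-- The large deviation lower bound. -/
lemma le_liminf_infoSpectrum (hU : U.Irreducible) (s₀ : S) {G : Set ℝ} (hG : IsOpen G) :
    - ⨅ t ∈ G, U.rate t ≤
      liminf (fun n : ℕ => ENNReal.log (infoSpectrum n (U.prob s₀ n) G) / (n : EReal)) atTop := by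
  classical
  rw [EReal.neg_le]
  refine le_iInf₂ fun t ht => le_iInf₂ fun Q hQ => ?_
  rw [EReal.neg_le, U.condRelEntropy_eq hQ.1.1.1 hQ.2.1, ← EReal.coe_neg]
  have hQt : U.meanInfo Q = t := hQ.2.2
  by_contra! hlt
  obtain ⟨b, hb1, hb2⟩ := EReal.lt_iff_exists_real_btwn.1 hlt
  refine hb1.not_ge ?_
  rw [EReal.coe_lt_coe_iff] at hb2
  obtain ⟨r, hr, hrG⟩ := Metric.isOpen_iff.1 hG t ht
  set ε := min r ((condEntropy Q - U.meanInfo Q - b) / 2) with hε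
  have hε0 : 0 < ε := lt_min hr (by linarith)
  have hεr : ε ≤ r := min_le_left _ _
  have hεb : ε ≤ (condEntropy Q - U.meanInfo Q - b) / 2 := min_le_right _ _
  refine le_liminf_of_le (by isBoundedDefault) ?_
  filter_upwards [U.exists_typical hU hQ.1 hQ.2.1 s₀ hε0, eventually_gt_atTop 0] with n hn hn0
  obtain ⟨A, hA, hAx⟩ := hn
  have hn1 : (0 : ℝ) < n := by exact_mod_cast hn0
  have hsub : A ⊆ Finset.univ.filter fun x => -(n : ℝ)⁻¹ * Real.log (U.prob s₀ n x) ∈ G := by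
    intro x hx
    refine Finset.mem_filter.2 ⟨Finset.mem_univ x, hrG ?_⟩
    have h1 := (hAx x hx).2
    have h2 : -(n : ℝ)⁻¹ * Real.log (U.prob s₀ n x) - t =
        -((n : ℝ)⁻¹ * (Real.log (U.prob s₀ n x) + n * U.meanInfo Q)) := by
      rw [hQt]; field_simp; ring
    rw [Metric.mem_ball, Real.dist_eq, h2, abs_neg, abs_mul, abs_of_pos (by positivity),
      inv_mul_lt_iff₀ hn1]
    exact h1.trans_le (mul_le_mul_of_nonneg_left hεr hn1.le)
  have hsum : Real.exp (n * b) ≤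
      ∑ x ∈ Finset.univ.filter fun x => -(n : ℝ)⁻¹ * Real.log (U.prob s₀ n x) ∈ G,
        U.prob s₀ n x := by
    calc Real.exp (n * b)
        ≤ Real.exp (n * (condEntropy Q - ε)) * Real.exp (-(n * (U.meanInfo Q + ε))) := by
          rw [← Real.exp_add]
          refine Real.exp_le_exp.2 ?_
          have := mul_le_mul_of_nonneg_left
            (show b ≤ condEntropy Q - U.meanInfo Q - 2 * ε by linarith) hn1.le
          linarith
      _ ≤ A.card * Real.exp (-(n * (U.meanInfo Q + ε))) :=
          mul_le_mul_of_nonneg_right hA (Real.exp_pos _).le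
      _ = ∑ _x ∈ A, Real.exp (-(n * (U.meanInfo Q + ε))) := by
          rw [Finset.sum_const, nsmul_eq_mul]
      _ ≤ ∑ x ∈ A, U.prob s₀ n x := Finset.sum_le_sum fun x hx => by
          rw [← Real.le_log_iff_exp_le (hAx x hx).1]
          linarith [(abs_lt.1 (hAx x hx).2).1]
      _ ≤ _ := Finset.sum_le_sum_of_subset_of_nonneg hsub fun x _ _ => U.prob_nonneg s₀ n x
  have hlog : ((n * b : ℝ) : EReal) ≤ ENNReal.log (infoSpectrum n (U.prob s₀ n) G) := by
    rw [infoSpectrum_apply (U.prob_nonneg s₀ n)]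
    refine le_trans ?_ (ENNReal.log_le_log (ENNReal.ofReal_le_ofReal hsum))
    rw [ENNReal.log_ofReal_of_pos (Real.exp_pos _), Real.log_exp]
  have hb : (b : EReal) = ((n * b : ℝ) : EReal) / (n : EReal) := by
    rw [show (n : EReal) = ((n : ℝ) : EReal) from rfl, ← EReal.coe_div,
      mul_div_cancel_left₀ _ hn1.ne']
  rw [hb]
  exact EReal.div_le_div_right_of_nonneg (by positivity) hlog

theorem largeDeviationProperty (hU : U.Irreducible) (s₀ : S) :
    LargeDeviationProperty (fun n => infoSpectrum n (U.prob s₀ n)) U.rate where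
  isProbabilityMeasure n := ⟨by
    classical
    simp [infoSpectrum_apply (U.prob_nonneg s₀ n), U.sum_prob]⟩
  nonneg := U.rate_nonneg
  lowerSemicontinuous := U.lowerSemicontinuous_rate
  isCompact_level := U.isCompact_setOf_rate_le
  limsup_le _ := U.limsup_infoSpectrum_le s₀
  le_liminf _ := U.le_liminf_infoSpectrum hU s₀

/-! ### The growth rate of guessing moments -/

/-- The value `ρ H(η ∣ q) - D(η ‖ π ∣ q)`, for a pmf that charges only pairs of positive
probability. -/
noncomputable def guessingValue (U : UnifilarSource S X) (ρ : ℝ) (Q : S × X → ℝ) : ℝ :=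
  ρ * condEntropy Q - (U.meanInfo Q - condEntropy Q)

lemma coe_guessingValue (ρ : ℝ) {Q : S × X → ℝ} (hQ : ∀ p, 0 ≤ Q p) (hac : U.AbsCont Q) :
    ((ρ * condEntropy Q : ℝ) : EReal) - U.condRelEntropy Q = (U.guessingValue ρ Q : EReal) := by
  rw [U.condRelEntropy_eq hQ hac, ← EReal.coe_sub, guessingValue]

lemma exists_max_guessingValue (hU : U.Irreducible) (s₀ : S) (ρ : ℝ) :
    ∃ Q ∈ stationaryPmfs U.φ, U.AbsCont Q ∧
      ∀ R ∈ stationaryPmfs U.φ, U.AbsCont R → U.guessingValue ρ R ≤ U.guessingValue ρ Q := by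
  obtain ⟨P, hP, hPac, -⟩ := U.exists_stationary_pos hU s₀
  have hc : ContinuousOn (U.guessingValue ρ) (stationaryPmfs U.φ ∩ {Q | U.AbsCont Q}) :=
    ((continuousOn_condEntropy.const_mul ρ).sub U.continuousOn_meanInfo_sub).mono
      fun Q hQ => hQ.1.1
  obtain ⟨Q, hQ, hmax⟩ := U.isCompact_stationary_absCont.exists_isMaxOn ⟨P, hP, hPac⟩ hc
  exact ⟨Q, hQ.1, hQ.2, fun R hR hRac => hmax ⟨hR, hRac⟩⟩

/-- The upper bound on the growth of guessing moments. The moment is assumed positive because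
`Real.log 0 = 0`. -/
lemma eventually_guessingMoment_lt (s₀ : S) {ρ : ℝ} (hρ : 0 < ρ) {E b : ℝ} (hb : E < b)
    (hE : ∀ R ∈ stationaryPmfs U.φ, U.AbsCont R → U.guessingValue ρ R ≤ E)
    (G : (n : ℕ) → (Fin n → X) → ℕ) (hG : ∀ n, IsOptimalGuessing (U.prob s₀ n) (G n)) :
    ∀ᶠ n : ℕ in atTop, 0 < guessingMoment (U.prob s₀ n) (G n) ρ →
      (n : ℝ)⁻¹ * Real.log (guessingMoment (U.prob s₀ n) (G n) ρ) < b := by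
  classical
  have := U.nonempty_letter s₀
  have hρ1 : 0 < 1 + ρ := by positivity
  -- The constant `a` leaves room on both sides: `E < (1 + ρ) a < b`.
  set a : ℝ := (E + b) / 2 / (1 + ρ) with ha
  have haE : E < (1 + ρ) * a := by rw [ha, mul_div_cancel₀ _ hρ1.ne']; linarith
  have hab : (1 + ρ) * a < b := by rw [ha, mul_div_cancel₀ _ hρ1.ne']; linarith
  set ψ : (S × X → ℝ) → ℝ := fun Q => U.meanInfo Q * (1 / (1 + ρ)) with hψ
  have hev := eventually_empirical_lt U.φ U.isClosed_absCont (continuousOn_condEntropy.sub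
    (U.continuous_meanInfo.mul_const (1 / (1 + ρ))).continuousOn) (a := a) fun Q hQ hQB => by
      have h1 := (hE Q hQ hQB).trans_lt haE
      rw [guessingValue] at h1
      have h2 : (1 + ρ) * (condEntropy Q - U.meanInfo Q * (1 / (1 + ρ))) < (1 + ρ) * a := by
        rw [mul_sub, mul_left_comm, mul_one_div_cancel hρ1.ne']
        linarith
      exact lt_of_mul_lt_mul_left h2 hρ1.le
  set d : ℝ := (1 + ρ) * (Fintype.card (S × X) : ℝ) with hd
  filter_upwards [hev, eventually_gt_atTop 0,
    (tendsto_log_succ_div d ((1 + ρ) * a)).eventually (gt_mem_nhds hab)] with n hn hn0 hlim hpos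
  have hn1 : (0 : ℝ) < n := by exact_mod_cast hn0
  have hZ : ∑ x, U.prob s₀ n x ^ (1 / (1 + ρ)) ≤
      ((n : ℝ) + 1) ^ Fintype.card (S × X) * Real.exp (n * a) := by
    refine le_trans ?_ (sum_exp_empirical_le U.φ s₀ hn0.ne' {Q | U.AbsCont Q} ψ
      fun x hx => (hn s₀ x hx).le)
    rw [Finset.sum_filter]
    refine Finset.sum_le_sum fun x _ => ?_
    by_cases h0 : U.prob s₀ n x = 0
    · rw [h0, Real.zero_rpow (by positivity)]
      split_ifs <;> positivity
    · have h1 : empirical U.φ s₀ n x ∈ {Q | U.AbsCont Q} := U.absCont_empirical h0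
      rw [if_pos h1, U.prob_eq_exp hn0.ne' h0, ← Real.exp_mul]
      refine Real.exp_le_exp.2 (le_of_eq ?_)
      simp only [hψ]; ring
  have hM := (guessingMoment_le (U.prob_nonneg s₀ n) (hG n) hρ).trans
    (Real.rpow_le_rpow (Finset.sum_nonneg fun x _ => Real.rpow_nonneg (U.prob_nonneg s₀ n x) _)
      hZ hρ1.le)
  have hlog := Real.log_le_log hpos hM
  rw [Real.log_rpow (by positivity), Real.log_mul (by positivity) (Real.exp_pos _).ne',
    Real.log_pow, Real.log_exp] at hlog
  refine lt_of_le_of_lt ?_ hlim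
  rw [← div_eq_inv_mul]
  refine div_le_div_of_nonneg_right (hlog.trans_eq ?_) hn1.le
  rw [hd]; ring

/-- The lower bound on the growth of guessing moments, from the words typical for `Q`. -/
lemma eventually_lt_guessingMoment (hU : U.Irreducible) (s₀ : S) {ρ : ℝ} (hρ : 0 < ρ)
    {Q : S × X → ℝ} (hQ : Q ∈ stationaryPmfs U.φ) (hac : U.AbsCont Q) {b : ℝ}
    (hb : b < U.guessingValue ρ Q)
    (G : (n : ℕ) → (Fin n → X) → ℕ) (hG : ∀ n, IsOptimalGuessing (U.prob s₀ n) (G n)) :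
    ∀ᶠ n : ℕ in atTop, 0 < guessingMoment (U.prob s₀ n) (G n) ρ ∧
      b < (n : ℝ)⁻¹ * Real.log (guessingMoment (U.prob s₀ n) (G n) ρ) := by
  have hρ1 : 0 < 1 + ρ := by positivity
  -- An error `ε` in entropy and information costs `(2 + ρ) ε` in the exponent.
  set ε : ℝ := (U.guessingValue ρ Q - b) / (2 * (2 + ρ)) with hε
  have hε0 : 0 < ε := div_pos (by linarith) (by positivity)
  have hεb : b < U.guessingValue ρ Q - (2 + ρ) * ε := by
    have : (2 + ρ) * ε = (U.guessingValue ρ Q - b) / 2 := by rw [hε]; field_simp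
    linarith
  have hlim : Tendsto (fun n : ℕ => U.guessingValue ρ Q - (2 + ρ) * ε -
      (1 + ρ) * Real.log 2 / n) atTop (𝓝 (U.guessingValue ρ Q - (2 + ρ) * ε - 0)) :=
    tendsto_const_nhds.sub (tendsto_const_div_atTop_nhds_zero_nat _)
  rw [sub_zero] at hlim
  filter_upwards [U.exists_typical hU hQ hac s₀ hε0, eventually_gt_atTop 0,
    hlim.eventually (lt_mem_nhds hεb)] with n hn hn0 hbn
  have hn1 : (0 : ℝ) < n := by exact_mod_cast hn0
  obtain ⟨A, hA, hAx⟩ := hn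
  have h1 := le_guessingMoment (U.prob_nonneg s₀ n) (hG n).1 hρ A
    (Real.exp_pos (-(n * (U.meanInfo Q + ε)))).le fun x hx => by
      rw [← Real.le_log_iff_exp_le (hAx x hx).1]
      linarith [(abs_lt.1 (hAx x hx).2).1]
  have h2 : Real.exp (-(n * (U.meanInfo Q + ε))) *
      (Real.exp (n * (condEntropy Q - ε)) / 2) ^ (1 + ρ) ≤
        guessingMoment (U.prob s₀ n) (G n) ρ :=
    le_trans (mul_le_mul_of_nonneg_left (Real.rpow_le_rpow (by positivity) (by linarith) hρ1.le)
      (Real.exp_pos _).le) h1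
  have hpos : 0 < Real.exp (-(n * (U.meanInfo Q + ε))) *
      (Real.exp (n * (condEntropy Q - ε)) / 2) ^ (1 + ρ) := by positivity
  refine ⟨hpos.trans_le h2, hbn.trans_le ?_⟩
  have h3 := Real.log_le_log hpos h2
  rw [Real.log_mul (Real.exp_pos _).ne' (by positivity), Real.log_rpow (by positivity),
    Real.log_div (Real.exp_pos _).ne' two_ne_zero, Real.log_exp, Real.log_exp] at h3
  rw [le_inv_mul_iff₀ hn1]
  refine le_trans (le_of_eq ?_) h3
  rw [guessingValue]
  field_simp
  ring

end UnifilarSource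

end GuessingLDP

open GuessingLDP in
theorem mainTheorem9 {S X : Type*} [Fintype S] [Fintype X]
    (U : GuessingLDP.UnifilarSource S X) (hU : U.Irreducible) (s₀ : S) :
    GuessingLDP.LargeDeviationProperty
        (fun n => GuessingLDP.infoSpectrum n (U.prob s₀ n)) U.rate ∧
      ∀ ρ : ℝ, 0 < ρ → ∃ E : ℝ,
        (∀ G : (n : ℕ) → (Fin n → X) → ℕ,
          (∀ n, GuessingLDP.IsOptimalGuessing (U.prob s₀ n) (G n)) →
          Tendsto (fun n : ℕ =>
            (n : ℝ)⁻¹ * Real.log (GuessingLDP.guessingMoment (U.prob s₀ n) (G n) ρ))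
            atTop (𝓝 E)) ∧
        (E : EReal) = ⨆ Q ∈ GuessingLDP.stationaryPmfs U.φ,
          ((ρ * GuessingLDP.condEntropy Q : ℝ) : EReal) - U.condRelEntropy Q ∧
        (E : EReal) = ⨆ Q ∈ GuessingLDP.irreducibleStationaryPmfs U.φ,
          ((ρ * GuessingLDP.condEntropy Q : ℝ) : EReal) - U.condRelEntropy Q := by
  refine ⟨U.largeDeviationProperty hU s₀, fun ρ hρ => ?_⟩
  obtain ⟨Q, hQ, hac, hmax⟩ := U.exists_max_guessingValue hU s₀ ρ
  have hle : ∀ R ∈ stationaryPmfs U.φ, ((ρ * condEntropy R : ℝ) : EReal) - U.condRelEntropy R ≤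
      (U.guessingValue ρ Q : EReal) := fun R hR => by
    by_cases hRac : U.AbsCont R
    · rw [U.coe_guessingValue ρ hR.1.1 hRac]
      exact EReal.coe_le_coe_iff.2 (hmax R hR hRac)
    · rw [U.condRelEntropy_eq_top hR.1.1 hRac, sub_eq_add_neg, EReal.neg_top, EReal.add_bot]
      exact bot_le
  refine ⟨U.guessingValue ρ Q, fun G hG => tendsto_order.2 ⟨fun b hb => ?_, fun b hb => ?_⟩,
    le_antisymm ?_ (iSup₂_le hle), le_antisymm ?_ (iSup₂_le fun R hR => hle R hR.1)⟩
  · exact (U.eventually_lt_guessingMoment hU s₀ hρ hQ hac hb G hG).mono fun n hn => hn.2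
  · filter_upwards [U.eventually_guessingMoment_lt s₀ hρ hb hmax G hG,
      U.eventually_lt_guessingMoment hU s₀ hρ hQ hac (sub_one_lt _) G hG] with n h1 h2
    exact h1 h2.1
  · rw [← U.coe_guessingValue ρ hQ.1.1 hac]
    exact le_iSup₂_of_le Q hQ le_rfl
  · by_contra! hlt
    obtain ⟨b, hb1, hb2⟩ := EReal.lt_iff_exists_real_btwn.1 hlt
    rw [EReal.coe_lt_coe_iff] at hb2
    -- Changes of entropy and mean information by `ε` change the value by at most `(2 + ρ) ε`.
    set ε : ℝ := (U.guessingValue ρ Q - b) / (2 + ρ) with hε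
    have hε0 : 0 < ε := div_pos (by linarith) (by positivity)
    have hεb : (2 + ρ) * ε = U.guessingValue ρ Q - b := mul_div_cancel₀ _ (by positivity)
    obtain ⟨R, hR, hRac, h1, h2⟩ := U.exists_irreducible_near hU s₀ hQ hac hε0
    have h3 := (le_iSup₂_of_le (f := fun R (_ : R ∈ irreducibleStationaryPmfs U.φ) =>
      ((ρ * condEntropy R : ℝ) : EReal) - U.condRelEntropy R) R hR le_rfl).trans_lt hb1
    rw [U.coe_guessingValue ρ hR.1.1.1 hRac, EReal.coe_lt_coe_iff] at h3
    have h4 : (1 + ρ) * (condEntropy Q - condEntropy R) < (1 + ρ) * ε :=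
      mul_lt_mul_of_pos_left (by linarith [(abs_lt.1 h1).1]) (by positivity)
    have h5 := (abs_lt.1 h2).2
    simp only [UnifilarSource.guessingValue] at h3 hεb
    linarith
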